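/- Let $p$ be a prime, $\mathbb{F}_q$ a finite field of characteristic $p$, and $\psi:\mathbb{F}_q\to\mathbb{Z}[1/p,\zeta_p]^\times$ a nontrivial character. Let $A\neq 0$ be a Noetherian commutative $\mathbb{Z}[1/p,\zeta_p]$-algebra and write $\psi_A:\mathbb{F}_q\to A^\times$ for the extension of $\psi$. Put $G_n=\mathrm{GL}_n(\mathbb{F}_q)$; let $P_n\le G_n$ be the mirabolic subgroup (last row $(0,\dots,0,1)$), $U_n$ its unipotent radical, $N_n$ the group of upper triangular unipotent matrices, and $U_{n,k}=\left\{\left(\begin{smallmatrix} I_{n-k}&z\\0&y\end{smallmatrix}\right): y\in N_k\right\}$. Extend $\psi_A$ to each of these unipotent groups by applying it to the sum of the entries just above the diagonal. For an $A[P_n]$-module $V$ let $\Phi^-V$ be its $(U_n,\psi_A)$-coinvariants, an $A[P_{n-1}]$-module, and $\Psi^-V$ its $U_n$-coinvariants, an $A[G_{n-1}]$-module. For an $A[G_n]$-module $V$ let $V^{(0)}=V$ and $V^{(k)}=\Psi^-(\Phi^-)^{k-1}(V|_{P_n})$, an $A[G_{n-k}]$-module, for $1\le k\le n$. Say that $V$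 is of $\psi$-Whittaker type if $V^{(n)}$ is a free $A$-module of rank one; its Whittaker model $\mathcal{W}(V,\psi_A)$ is then the space of functions $g\mapsto\lambda(gv)$ on $G_n$, $v\in V$, where $\lambda: V\to V^{(n)}\to A$ comes from a generator of $\mathrm{Hom}_A(V^{(n)},A)$ (the space does not depend on the generator), with $G_n$ acting by right translation. The same notions are used with $\psi^{-1}$ in place of $\psi$. Let $n>m\ge 1$. Let $\pi$ be an $A[G_n]$-module of $\psi$-Whittaker type and $\pi'$ an $A[G_m]$-module of $\psi^{-1}$-Whittaker type (equivalently, of $\psi$-Whittaker type), and put $\mathcal{W}=\mathcal{W}(\pi,\psi_A)$, $\mathcal{W}'=\mathcal{W}(\pi',\psi_A^{-1})$. Assume that $\pi'$ is not exceptional for $\pi$: for every $t\in\{1,\dots,m\}$ there is no nonzero $G_t$-invariant $A$-bilinear form $\mathcal{W}^{(n-t)}\times(\mathcal{W}')^{(m-t)}\to A$, where derivatives of $\mathcal{W}$ are taken with respect to $\psi$ and those of $\mathcal{W}'$ with respect to $\psi^{-1}$. For $W\in\mathcal{W}$, $W'\in\mathcal{W}'$ put $$I(W,W';0)=\sum_{x\in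 N_m\backslash G_m}W\left(\begin{smallmatrix}x&0\\0&I_{n-m}\end{smallmatrix}\right)W'(x).$$ (1) The $A$-module of $A$-bilinear forms $B:\mathcal{W}\times\mathcal{W}'\to A$ such that $B(guW,gW')=\psi_A(u)B(W,W')$ for all $g\in G_m$ (embedded in $G_n$ as $\mathrm{diag}(g,I_{n-m})$) and $u\in U_{n,n-m-1}$ is free of rank one, with basis $(W,W')\mapsto I(W,W';0)$. (2) There is a unit $\gamma(\pi\times\pi',\psi)\in A^\times$ that is the unique element $\gamma$ of $A$ such that, for all $W\in\mathcal{W}$ and $W'\in\mathcal{W}'$, $$I(W,W';0)\,\gamma=\sum_{x\in N_m\backslash G_m}\ \sum_{y\in \mathrm{Mat}_{m,n-m-1}(\mathbb{F}_q)}W\left(\begin{smallmatrix}0&1&0\\0&0&I_{n-m-1}\\x&0&y\end{smallmatrix}\right)W'(x).$$ (3) For every homomorphism $f:A\to A'$ of commutative rings, $\pi\otimes_AA'$ is of $\psi$-Whittaker type and $\pi'\otimes_AA'$ is of $\psi^{-1}$-Whittaker type over $A'$, and $f(\gamma(\pi\times\pi',\psi))$ is the unique element of $A'$ that satisfies the functional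 equation in (2) for $\pi\otimes_AA'$ and $\pi'\otimes_AA'$. -/

import Mathlib

open scoped TensorProduct

namespace FiniteGL

noncomputable section

universe u v w

/-- `G_n = GL_n(F)`. -/
abbrev GLn (n : ℕ) (F : Type*) [Field F] := Matrix.GeneralLinearGroup (Fin n) F

/-- The ring `ℤ[1/p, ζ_p]`. -/
abbrev BaseRing (p : ℕ) := Localization.Away (p : CyclotomicRing p ℤ ℚ)

/-! ### Subgroups of `GL_n(F)` -/

section Groups

variable {F : Type*} [Field F]

/-- The first `a` and the last `b` indices of an index set of size `n = a + b`. -/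
def blockEquiv {a b n : ℕ} (h : a + b = n) : Fin a ⊕ Fin b ≃ Fin n :=
  finSumFinEquiv.trans (finCongr h)

/-- The embedding `g ↦ diag(g, I_b)` of `GL_a` into `GL_n`, where `n = a + b`. -/
def corner {a b n : ℕ} (h : a + b = n) : GLn a F →* GLn n F :=
  Units.map
    { toFun := fun g =>
        Matrix.reindex (blockEquiv h) (blockEquiv h) (Matrix.fromBlocks g 0 0 1)
      map_one' := by
        rw [Matrix.fromBlocks_one]; simp
      map_mul' := fun x y => by
        simp only [Matrix.reindex_apply]
        rw [Matrix.submatrix_mul_equiv, Matrix.fromBlocks_multiply]; simp }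

/-- The identification of `GL_a` with `GL_b` when `a = b`. -/
def castGL {a b : ℕ} (h : a = b) : GLn a F →* GLn b F :=
  Units.map (Matrix.reindexAlgEquiv F F (finCongr h) :
    Matrix (Fin a) (Fin a) F →* Matrix (Fin b) (Fin b) F)

/-- The matrix `(I_n y; 0 1)` of size `n + 1`. -/
def unipMatrix {n : ℕ} (y : Fin n → F) : Matrix (Fin (n + 1)) (Fin (n + 1)) F :=
  Matrix.reindex finSumFinEquiv finSumFinEquiv
    (Matrix.fromBlocks 1 (Matrix.replicateCol (Fin 1) y) 0 1)

theorem unipMatrix_mul {n : ℕ} (y z : Fin n → F) :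
    unipMatrix y * unipMatrix z = unipMatrix (y + z) := by
  simp only [unipMatrix, Matrix.reindex_apply]
  rw [Matrix.submatrix_mul_equiv, Matrix.fromBlocks_multiply]
  simp [Matrix.replicateCol_add, add_comm]

theorem unipMatrix_zero {n : ℕ} : unipMatrix (0 : Fin n → F) = 1 := by
  have : Matrix.replicateCol (Fin 1) (0 : Fin n → F) = 0 := by ext; simp
  simp only [unipMatrix, this]
  rw [Matrix.fromBlocks_one]; simp

/-- The element `(I_n y; 0 1)` of the unipotent radical `U_{n+1}` of the mirabolic subgroup. -/
def unip {n : ℕ} (y : Fin n → F) : GLn (n + 1) F where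
  val := unipMatrix y
  inv := unipMatrix (-y)
  val_inv := by rw [unipMatrix_mul, add_neg_cancel, unipMatrix_zero]
  inv_val := by rw [unipMatrix_mul, neg_add_cancel, unipMatrix_zero]

variable (F) in
/-- The mirabolic subgroup `P_{n+1}` of `GL_{n+1}`: the matrices with last row `(0, …, 0, 1)`. -/
def mirabolic (n : ℕ) : Subgroup (GLn (n + 1) F) where
  carrier := {g | (g : Matrix (Fin (n + 1)) (Fin (n + 1)) F) (Fin.last n) =
    Pi.single (Fin.last n) 1}
  one_mem' := by
    ext j
    simp [Matrix.one_apply, Pi.single_apply, eq_comm]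
  mul_mem' := by
    intro g h hg hh
    simp only [Set.mem_ofPred_eq] at hg hh ⊢
    rw [Units.val_mul, Matrix.mul_apply_eq_vecMul, hg, Matrix.single_one_vecMul]
    exact hh
  inv_mem' := by
    intro g hg
    simp only [Set.mem_ofPred_eq] at hg ⊢
    have h1 : Matrix.vecMul (Pi.single (Fin.last n) 1)
        (g : Matrix (Fin (n + 1)) (Fin (n + 1)) F) = Pi.single (Fin.last n) 1 := by
      rw [Matrix.single_one_vecMul]; exact hg
    have h2 : Matrix.vecMul (Pi.single (Fin.last n) 1)
        ((g⁻¹ : GLn (n + 1) F) : Matrix (Fin (n + 1)) (Fin (n + 1)) F)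
        = Pi.single (Fin.last n) 1 := by
      conv_lhs => rw [← h1]
      rw [Matrix.vecMul_vecMul, ← Units.val_mul, mul_inv_cancel]
      simp
    rw [Matrix.single_one_vecMul] at h2
    exact h2

theorem corner_mem_mirabolic {n : ℕ} (g : GLn n F) :
    corner (rfl : n + 1 = n + 1) g ∈ mirabolic F n := by
  change Matrix.reindex (blockEquiv rfl) (blockEquiv rfl)
    (Matrix.fromBlocks (g : Matrix (Fin n) (Fin n) F) 0 0 1) (Fin.last n) = _
  ext j
  refine Fin.lastCases ?_ (fun j => ?_) j
  · simp [blockEquiv]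
  · simp [blockEquiv]

theorem unip_mem_mirabolic {n : ℕ} (y : Fin n → F) : unip y ∈ mirabolic F n := by
  change unipMatrix y (Fin.last n) = _
  ext j
  refine Fin.lastCases ?_ (fun j => ?_) j
  · simp [unipMatrix]
  · simp [unipMatrix]

/-- The embedding `g ↦ diag(g, 1)` of `GL_n` into `P_{n+1}`. -/
def cornerP {n : ℕ} : GLn n F →* mirabolic F n :=
  (corner (rfl : n + 1 = n + 1)).codRestrict (mirabolic F n) corner_mem_mirabolic

/-- `(I_n y; 0 1)` as an element of `P_{n+1}`. -/
def unipP {n : ℕ} (y : Fin n → F) : mirabolic F n := ⟨unip y, unip_mem_mirabolic y⟩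

theorem cornerP_mul_unipP {n : ℕ} (g : GLn n F) (y : Fin n → F) :
    cornerP g * unipP y
      = unipP (Matrix.mulVec (g : Matrix (Fin n) (Fin n) F) y) * cornerP g := by
  apply Subtype.ext
  apply Units.ext
  change Matrix.reindex (blockEquiv rfl) (blockEquiv rfl)
      (Matrix.fromBlocks (g : Matrix (Fin n) (Fin n) F) 0 0 1) * unipMatrix y
    = unipMatrix _ * Matrix.reindex (blockEquiv rfl) (blockEquiv rfl)
      (Matrix.fromBlocks (g : Matrix (Fin n) (Fin n) F) 0 0 1)
  have hb : blockEquiv (rfl : n + 1 = n + 1) = finSumFinEquiv := by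
    ext x; simp [blockEquiv]
  rw [hb]
  simp only [unipMatrix, Matrix.reindex_apply]
  rw [Matrix.submatrix_mul_equiv, Matrix.submatrix_mul_equiv, Matrix.fromBlocks_multiply,
    Matrix.fromBlocks_multiply]
  simp [Matrix.replicateCol_mulVec]

variable (F) in
/-- The subgroup `U_{n,k}` of the matrices `(I_{n-k} z; 0 y)` with `y` upper triangular unipotent
of size `k`: the entries below the diagonal, on the diagonal, and in the first `n - k` columns
are those of the identity matrix. -/
def unipSubgroup [Finite F] (n k : ℕ) : Subgroup (GLn n F) :=
  let S : Submonoid (GLn n F) :=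
    { carrier := {g | ∀ i j : Fin n, (j ≤ i ∨ (j : ℕ) + k < n) →
        (g : Matrix (Fin n) (Fin n) F) i j = (1 : Matrix (Fin n) (Fin n) F) i j}
      one_mem' := fun _ _ _ => rfl
      mul_mem' := by
        intro g h hg hh i j hij
        rw [Units.val_mul, Matrix.mul_apply, Finset.sum_eq_single i]
        · rw [hg i i (Or.inl le_rfl), hh i j hij]; simp
        · intro l _ hl
          rcases lt_or_gt_of_ne hl with hlt | hgt
          · rw [hg i l (Or.inl hlt.le), Matrix.one_apply_ne hlt.ne', zero_mul]
          · rcases hij with hji | hjk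
            · rw [hh l j (Or.inl (hji.trans hgt.le)),
                Matrix.one_apply_ne (lt_of_le_of_lt hji hgt).ne', mul_zero]
            · rw [hh l j (Or.inr hjk)]
              by_cases hlj : l = j
              · subst hlj
                rw [hg i l (Or.inr hjk), Matrix.one_apply_ne hgt.ne, zero_mul]
              · rw [Matrix.one_apply_ne hlj, mul_zero]
        · simp }
  { S with
    inv_mem' := by
      intro g hg
      have hfin : IsOfFinOrder g := isOfFinOrder_of_finite g
      have : g⁻¹ = g ^ (orderOf g - 1) := by
        rw [inv_eq_iff_mul_eq_one, ← pow_succ', Nat.sub_add_cancel hfin.orderOf_pos,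
          pow_orderOf_eq_one]
      change g⁻¹ ∈ S
      rw [this]
      exact S.pow_mem hg _ }

variable (F) in
/-- The subgroup `N_n` of upper triangular unipotent matrices. -/
abbrev maxUnip [Finite F] (n : ℕ) : Subgroup (GLn n F) := unipSubgroup F n n

/-- The sum of the entries just above the diagonal. -/
def superdiagSum {n : ℕ} (g : GLn n F) : F :=
  ∑ i : Fin n, ∑ j : Fin n,
    if (i : ℕ) + 1 = j then (g : Matrix (Fin n) (Fin n) F) i j else 0

/-- The sum of `f` over `N_n \ G_n`, for a function `f` that is invariant under left translation
by `N_n`; it is computed through representatives of the cosets `N_n x`. -/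
def cosetSum [Finite F] {R : Type*} [AddCommMonoid R] {n : ℕ} (f : GLn n F → R) : R :=
  ∑ᶠ x : Quotient (QuotientGroup.rightRel (maxUnip F n)), f x.out

/-- The value of `cosetSum` does not depend on the choice of representatives. -/
theorem cosetSum_eq [Finite F] {R : Type*} [AddCommMonoid R] {n : ℕ} (f : GLn n F → R)
    (hf : ∀ u ∈ maxUnip F n, ∀ x, f (u * x) = f x)
    (s : Quotient (QuotientGroup.rightRel (maxUnip F n)) → GLn n F)
    (hs : ∀ x, Quotient.mk _ (s x) = x) : cosetSum f = ∑ᶠ x, f (s x) := by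
  refine finsum_congr fun x => ?_
  have h : Quotient.mk (QuotientGroup.rightRel (maxUnip F n)) (s x) = Quotient.mk _ x.out := by
    rw [hs, Quotient.out_eq]
  have h' := QuotientGroup.rightRel_apply.mp (Quotient.exact h)
  simpa using hf _ h' (s x)

/-- The matrix `(0 1 0; 0 0 I_r; x 0 y)` of size `n = m + 1 + r`, where `x ∈ GL_m` and `y` is an
`m × r` matrix. Its block of rows of height `m` is `(x | 0 y)`, below `(0 | I_{r+1})`. -/
def dualElt {m r n : ℕ} (h : m + (r + 1) = n) (x : GLn m F) (y : Matrix (Fin m) (Fin r) F) :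
    GLn n F :=
  let Y : Matrix (Fin m) (Fin (r + 1)) F := fun i => Fin.cons 0 (y i)
  let e₁ : Fin (r + 1) ⊕ Fin m ≃ Fin n := blockEquiv ((Nat.add_comm _ _).trans h)
  let e₂ : Fin m ⊕ Fin (r + 1) ≃ Fin n := blockEquiv h
  let x' : Matrix (Fin m) (Fin m) F := (x⁻¹ : GLn m F)
  { val := Matrix.reindex e₁ e₂ (Matrix.fromBlocks 0 1 (x : Matrix (Fin m) (Fin m) F) Y)
    inv := Matrix.reindex e₂ e₁ (Matrix.fromBlocks (-(x' * Y)) x' 1 0)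
    val_inv := by
      simp only [Matrix.reindex_apply]
      rw [Matrix.submatrix_mul_equiv, Matrix.fromBlocks_multiply]
      have hx : (x : Matrix (Fin m) (Fin m) F) * x' = 1 := by
        simp only [x', ← Units.val_mul, mul_inv_cancel, Units.val_one]
      simp only [Matrix.mul_neg, ← Matrix.mul_assoc, hx]
      simp
    inv_val := by
      simp only [Matrix.reindex_apply]
      rw [Matrix.submatrix_mul_equiv, Matrix.fromBlocks_multiply]
      have hx : x' * (x : Matrix (Fin m) (Fin m) F) = 1 := by
        simp only [x', ← Units.val_mul, inv_mul_cancel, Units.val_one]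
      simp only [hx]
      simp }

end Groups

/-- If `m < n`, then `n = m + 1 + r` with `r = n - m - 1`. -/
theorem splitting {m n : ℕ} (h : m < n) : m + (n - m - 1 + 1) = n := by omega

/-! ### Derivatives -/

section Derivatives

variable {F : Type*} [Field F] {R : Type u} [CommRing R]

/-- The submodule `V(U_{n+1}, θ)` generated by the elements `u v - θ(u) v`. -/
def coinvKer {n : ℕ} (V : Rep.{v} R (mirabolic F n)) (θ : (Fin n → F) → R) : Submodule R V.V :=
  Submodule.span R {w | ∃ (y : Fin n → F) (x : V.V), w = V.ρ (unipP y) x - θ y • x}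

theorem coinvKer_le_comap {n : ℕ} (V : Rep.{v} R (mirabolic F n)) (θ : (Fin n → F) → R)
    (g : GLn n F) (hg : ∀ y, θ (Matrix.mulVec (g : Matrix (Fin n) (Fin n) F) y) = θ y) :
    coinvKer V θ ≤ (coinvKer V θ).comap (V.ρ (cornerP g)) := by
  refine Submodule.span_le.mpr ?_
  rintro _ ⟨y, x, rfl⟩
  refine Submodule.subset_span
    ⟨Matrix.mulVec (g : Matrix (Fin n) (Fin n) F) y, V.ρ (cornerP g) x, ?_⟩
  rw [map_sub, map_smul, hg, ← Module.End.mul_apply, ← Module.End.mul_apply, ← map_mul,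
    ← map_mul, cornerP_mul_unipP]

/-- The functor `Ψ⁻ : Rep(P_{n+1}) → Rep(G_n)`, the coinvariants of the trivial character of
`U_{n+1}`. -/
def psiMinus {n : ℕ} (V : Rep.{v} R (mirabolic F n)) : Rep.{v} R (GLn n F) :=
  Rep.of (Representation.quotient (V.ρ.comp cornerP) (coinvKer V fun _ => 1)
    (fun g => coinvKer_le_comap V _ g fun _ => rfl))

theorem mulVec_last_of_mem_mirabolic {n : ℕ} (g : mirabolic F n) (y : Fin (n + 1) → F) :
    Matrix.mulVec ((g : GLn (n + 1) F) : Matrix (Fin (n + 1)) (Fin (n + 1)) F) y (Fin.last n)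
      = y (Fin.last n) := by
  have h : ((g : GLn (n + 1) F) : Matrix (Fin (n + 1)) (Fin (n + 1)) F) (Fin.last n)
    = Pi.single (Fin.last n) 1 := g.2
  rw [Matrix.mulVec, h, single_one_dotProduct]

/-- The functor `Φ⁻ : Rep(P_{n+2}) → Rep(P_{n+1})`, the coinvariants of the character
`(I y; 0 1) ↦ ψ(y_{n+1})` of `U_{n+2}`, where `y = (y_1, …, y_{n+1})`. -/
def phiMinus (ψ : AddChar F R) {n : ℕ} (V : Rep.{v} R (mirabolic F (n + 1))) :
    Rep.{v} R (mirabolic F n) :=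
  Rep.of (Representation.quotient (V.ρ.comp (cornerP.comp (mirabolic F n).subtype))
    (coinvKer V fun y => ψ (y (Fin.last n)))
    (fun g => coinvKer_le_comap V _ g fun y => by
      simp only [mulVec_last_of_mem_mirabolic]))

/-- The iterate `(Φ⁻)^k : Rep(P_{t+k+1}) → Rep(P_{t+1})`. -/
def phiMinusIter (ψ : AddChar F R) {t : ℕ} :
    (k : ℕ) → Rep.{v} R (mirabolic F (t + k)) → Rep.{v} R (mirabolic F t)
  | 0, V => V
  | k + 1, V => phiMinusIter ψ k (phiMinus ψ (n := t + k) V)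

/-- The quotient map `V → (Φ⁻)^k V`. -/
def phiMinusIterMk (ψ : AddChar F R) {t : ℕ} :
    (k : ℕ) → (V : Rep.{v} R (mirabolic F (t + k))) → V.V →ₗ[R] (phiMinusIter ψ k V).V
  | 0, _ => LinearMap.id
  | k + 1, V => phiMinusIterMk ψ k (phiMinus ψ (n := t + k) V) ∘ₗ
      (coinvKer V fun y => ψ (y (Fin.last (t + k)))).mkQ

/-- The derivative `V^{(k)}`, a representation of `G_t`, of a representation `V` of `G_{t+k}`:
`V^{(0)} = V`, and `V^{(k)} = Ψ⁻ (Φ⁻)^{k-1} V|_P` for `k ≥ 1`. -/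
def derivativeAux (ψ : AddChar F R) {t : ℕ} :
    (k : ℕ) → Rep.{v} R (GLn (t + k) F) → Rep.{v} R (GLn t F)
  | 0, V => V
  | k + 1, V => psiMinus (phiMinusIter ψ k (Rep.of (V.ρ.comp (mirabolic F (t + k)).subtype)))

/-- The quotient map `V → V^{(k)}`. -/
def derivativeAuxMk (ψ : AddChar F R) {t : ℕ} :
    (k : ℕ) → (V : Rep.{v} R (GLn (t + k) F)) → V.V →ₗ[R] (derivativeAux ψ k V).V
  | 0, _ => LinearMap.id
  | k + 1, V => (coinvKer (phiMinusIter ψ k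
        (Rep.of (V.ρ.comp (mirabolic F (t + k)).subtype))) fun _ => 1).mkQ ∘ₗ
      phiMinusIterMk ψ k (Rep.of (V.ρ.comp (mirabolic F (t + k)).subtype))

/-- The derivative `V^{(k)}` with respect to `ψ`, a representation of `G_t`, of a representation
`V` of `G_n`, where `n = t + k`. -/
def derivative (ψ : AddChar F R) {t k n : ℕ} (h : t + k = n) (V : Rep.{v} R (GLn n F)) :
    Rep.{v} R (GLn t F) :=
  derivativeAux ψ k (Rep.of (V.ρ.comp (castGL h)))

/-- The quotient map `V → V^{(k)}`. -/
def derivativeMk (ψ : AddChar F R) {t k n : ℕ} (h : t + k = n) (V : Rep.{v} R (GLn n F)) :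
    V.V →ₗ[R] (derivative ψ h V).V :=
  derivativeAuxMk ψ k (Rep.of (V.ρ.comp (castGL h)))

end Derivatives

/-! ### Whittaker models -/

section Whittaker

variable {F : Type*} [Field F] {R : Type u} [CommRing R]

/-- The top derivative `V^{(n)}` of a representation of `G_n`. -/
abbrev topDerivative (ψ : AddChar F R) {n : ℕ} (V : Rep.{v} R (GLn n F)) :
    Rep.{v} R (GLn 0 F) :=
  derivative ψ (Nat.zero_add n) V

/-- `V` is of `ψ`-Whittaker type: `V^{(n)}` is a free `R`-module of rank one. -/
def IsWhittakerType (ψ : AddChar F R) {n : ℕ} (V : Rep.{v} R (GLn n F)) : Prop :=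
  Nonempty ((topDerivative ψ V).V ≃ₗ[R] R)

/-- The map from `V` to functions on `G_n` attached by Frobenius reciprocity to a linear form
`l` on `V^{(n)}`: it sends `v` to `g ↦ l(g v)`. -/
def whittakerMap (ψ : AddChar F R) {n : ℕ} (V : Rep.{v} R (GLn n F))
    (l : (topDerivative ψ V).V →ₗ[R] R) : V.V →ₗ[R] (GLn n F → R) :=
  LinearMap.pi fun g => l ∘ₗ derivativeMk ψ (Nat.zero_add n) V ∘ₗ V.ρ g

/-- The Whittaker model of `V`, as a space of functions on `G_n`: the sum of the images of the
maps `V → Ind ψ` attached to the linear forms on `V^{(n)}`. If `V` is of Whittaker type, it is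
the image of the map attached to any generator (`whittakerModel_eq_range`). -/
def whittakerModel (ψ : AddChar F R) {n : ℕ} (V : Rep.{v} R (GLn n F)) :
    Submodule R (GLn n F → R) :=
  ⨆ l : (topDerivative ψ V).V →ₗ[R] R, LinearMap.range (whittakerMap ψ V l)

theorem whittakerModel_eq_range (ψ : AddChar F R) {n : ℕ} (V : Rep.{v} R (GLn n F))
    (l : (topDerivative ψ V).V →ₗ[R] R) (hl : Submodule.span R {l} = ⊤) :
    whittakerModel ψ V = LinearMap.range (whittakerMap ψ V l) := by
  refine le_antisymm (iSup_le fun l' => ?_) (le_iSup (fun l' => LinearMap.range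
    (whittakerMap ψ V l')) l)
  obtain ⟨c, rfl⟩ := Submodule.mem_span_singleton.mp (hl ▸ Submodule.mem_top : l' ∈ _)
  rintro _ ⟨x, rfl⟩
  refine ⟨c • x, ?_⟩
  ext g
  simp [whittakerMap]

/-- Right translation on functions on `G_n`. -/
def rightTranslation (R : Type u) [CommRing R] (F : Type*) [Field F] (n : ℕ) :
    Representation R (GLn n F) (GLn n F → R) where
  toFun g := LinearMap.funLeft R R fun x => x * g
  map_one' := by ext; simp [LinearMap.funLeft]
  map_mul' g h := by ext; simp [LinearMap.funLeft, mul_assoc]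

theorem whittakerModel_le_comap (ψ : AddChar F R) {n : ℕ} (V : Rep.{v} R (GLn n F))
    (g : GLn n F) :
    whittakerModel ψ V ≤ (whittakerModel ψ V).comap (rightTranslation R F n g) := by
  refine iSup_le fun l => ?_
  rintro _ ⟨x, rfl⟩
  refine Submodule.mem_iSup_of_mem l ⟨V.ρ g x, ?_⟩
  ext a
  simp [whittakerMap, rightTranslation, LinearMap.funLeft]

/-- The Whittaker model of `V` as a representation of `G_n` by right translation. -/
def whittakerRep (ψ : AddChar F R) {n : ℕ} (V : Rep.{v} R (GLn n F)) :
    Rep R (GLn n F) :=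
  Rep.of ((rightTranslation R F n).subrepresentation (whittakerModel ψ V)
    (whittakerModel_le_comap ψ V))

end Whittaker

/-! ### Bilinear forms and zeta sums -/

section Forms

variable {F : Type*} [Field F] {R : Type u} [CommRing R]

/-- `Bil_G(V, V', 1)`, the module of `G`-invariant bilinear forms. -/
def invariantForms {G : Type*} [Group G] (V : Rep.{v} R G) (V' : Rep.{w} R G) :
    Submodule R (V.V →ₗ[R] V'.V →ₗ[R] R) where
  carrier := {B | ∀ g x x', B (V.ρ g x) (V'.ρ g x') = B x x'}
  zero_mem' := fun _ _ _ => rfl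
  add_mem' := fun {B C} hB hC g x x' => by simp [hB g x x', hC g x x']
  smul_mem' := fun c B hB g x x' => by simp [hB g x x']

/-- `V'` is exceptional for `V`: for some `1 ≤ t ≤ min(m, n)` there is a nonzero `G_t`-invariant
bilinear form on the product of the derivatives, `W(V, ψ)^{(n-t)} × W(V', ψ⁻¹)^{(m-t)}`. Here the
derivatives of `W(V, ψ)` are taken with respect to `ψ` and those of `W(V', ψ⁻¹)` with respect to
`ψ⁻¹`. -/
def IsExceptional (ψ : AddChar F R) {n m : ℕ} (V : Rep.{v} R (GLn n F))
    (V' : Rep.{w} R (GLn m F)) : Prop :=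
  ∃ (t k l : ℕ) (hk : t + k = n) (hl : t + l = m), 1 ≤ t ∧
    invariantForms (derivative ψ hk (whittakerRep ψ V))
      (derivative ψ⁻¹ hl (whittakerRep ψ⁻¹ V')) ≠ ⊥

variable [Finite F]

/-- `Bil_{G_m U_{n,r}}(W(V, ψ), W(V', ψ⁻¹), 1 ⊗ ψ)`, where `n = m + 1 + r`: the bilinear forms `B`
with `B(g u W, g W') = ψ(u) B(W, W')` for `g ∈ G_m` and `u ∈ U_{n,r}`. The group `U_{n,r}` acts
trivially on `W(V', ψ⁻¹)`. -/
def equivariantForms (ψ : AddChar F R) {m r n : ℕ} (h : m + (r + 1) = n)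
    (V : Rep.{v} R (GLn n F)) (V' : Rep.{w} R (GLn m F)) :
    Submodule R ((whittakerRep ψ V).V →ₗ[R] (whittakerRep ψ⁻¹ V').V →ₗ[R] R) where
  carrier := {B | ∀ g : GLn m F, ∀ u ∈ unipSubgroup F n r, ∀ W W',
    B ((whittakerRep ψ V).ρ (corner h g * u) W) ((whittakerRep ψ⁻¹ V').ρ g W')
      = ψ (superdiagSum u) * B W W'}
  zero_mem' := fun _ _ _ _ _ => by simp
  add_mem' := fun {B C} hB hC g u hu W W' => by
    rw [LinearMap.add_apply, LinearMap.add_apply, hB g u hu W W', hC g u hu W W', ← mul_add]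
    rfl
  smul_mem' := fun c B hB g u hu W W' => by
    rw [LinearMap.smul_apply, LinearMap.smul_apply, hB g u hu W W', smul_eq_mul, mul_left_comm]
    rfl

/-- The zeta sum `I(W, W'; 0) = ∑_{x ∈ N_m \ G_m} W(diag(x, I_{n-m})) W'(x)`. -/
def zetaSum {m r n : ℕ} (h : m + (r + 1) = n) (W : GLn n F → R) (W' : GLn m F → R) : R :=
  cosetSum fun x => W (corner h x) * W' x

/-- The dual zeta sum
`∑_{x ∈ N_m \ G_m} ∑_{y ∈ Mat_{m,r}} W(0 1 0; 0 0 I_r; x 0 y) W'(x)`, with `r = n - m - 1`. -/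
def dualZetaSum {m r n : ℕ} (h : m + (r + 1) = n) (W : GLn n F → R) (W' : GLn m F → R) : R :=
  cosetSum fun x => ∑ᶠ y : Matrix (Fin m) (Fin r) F, W (dualElt h x y) * W' x

/-- `c` satisfies the functional equation for `V` and `V'`:
`I(W, W'; 0) c` is the dual zeta sum, for all `W ∈ W(V, ψ)` and `W' ∈ W(V', ψ⁻¹)`. -/
def FunctionalEquation (ψ : AddChar F R) {m r n : ℕ} (h : m + (r + 1) = n)
    (V : Rep.{v} R (GLn n F)) (V' : Rep.{w} R (GLn m F)) (c : R) : Prop :=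
  ∀ W ∈ whittakerModel ψ V, ∀ W' ∈ whittakerModel ψ⁻¹ V',
    zetaSum h W W' * c = dualZetaSum h W W'

/-- Extension of scalars `V ⊗_R R'` of a representation. -/
def baseChange {G : Type*} [Group G] (R' : Type w) [CommRing R'] [Algebra R R']
    (V : Rep.{v} R G) : Rep R' G :=
  Rep.of ((Module.End.baseChangeHom R R' V.V : Module.End R V.V →*
    Module.End R' (R' ⊗[R] V.V)).comp V.ρ)

end Forms

/-- The extension `ψ_R : F → Rˣ` of a character with values in `ℤ[1/p, ζ_p]` along the structure
morphism of a `ℤ[1/p, ζ_p]`-algebra `R`. -/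
abbrev extendChar {F : Type*} [Field F] {p : ℕ} (ψ : AddChar F (BaseRing p)) (R : Type u)
    [CommRing R] [Algebra (BaseRing p) R] : AddChar F R :=
  (algebraMap (BaseRing p) R : BaseRing p →* R).compAddChar ψ

end

end FiniteGL

open FiniteGL

/-!
Write `ψ` for the character over the coefficient ring `A`. Nontriviality of the character over
`ℤ[1/p, ζ_p]` enters only through `∑ x, ψ x = 0`, which survives in any algebra (where there may be
zero divisors) and, together with the invertibility of `|F|`, gives Fourier analysis on the
unipotent radical `U_{d+1}` of the mirabolic group `P_{d+1}`: a module is the direct sum of its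
eigenspaces, `GL_d` permutes those of nontrivial characters transitively, and coinvariants are
identified with eigenspaces (`IsFourierChar`, `sum_avg`, `avg_mem_coinvKer`).

An equivariant form `B` on `W(V, ψ) × W(V', ψ⁻¹)` descends to a `GL_m`-invariant form on
`(Φ⁻)^{n-m-1} W(V, ψ) × W(V', ψ⁻¹)`. The eigenspaces for `ψ` and the trivial character give
`Φ⁻` and `Ψ⁻`, so an induction on the rank shows that the only obstructions to `B` being determined
by its values on pairs of Whittaker vectors (eigenvectors of the maximal unipotent groups) are
invariant forms on pairs of derivatives `(n - t, m - t)` with `1 ≤ t ≤ m`. Nonexceptionality says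
that there are none (`eq_zero_of_mem_equivariantForms`). Since the top derivatives are free of
rank one, the Whittaker vectors of the two models are the multiples of a normalized Bessel function
`W₀`, respectively `W₀'` (`exists_bessel`). So `B ↦ B(W₀, W₀')` is injective.

A Bessel function is supported on `N_n` within the mirabolic group
(`IsBessel.eq_zero_of_mem_mirabolic`), hence `I(W₀, W₀'; 0) = 1` and the zeta form is a basis. The
dual zeta sum is an equivariant form too, hence equals `γ` times the zeta form for some `γ`. Transposing
about the antidiagonal, a Bessel function is also supported on `N_n` within the matrices with first
column `(1, 0, …, 0)`, so the dual zeta sum takes the value `1` at a translate of `W₀` and at `W₀'`,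
and `γ` is a unit (`exists_basis_and_gamma`).

For an extension of scalars `A → A'`, a Whittaker functional over `A` extends to one over `A'`
(`IsWhittakerFunctional.baseChange`) and the Whittaker models over `A'` are spanned by the images of
those over `A`. The functional equation and a pair with `I(W, W'; 0) = 1` therefore carry over, and
the second makes the factor unique (`FunctionalEquation.baseChange`).
-/

namespace FiniteGL

noncomputable section

universe u v w u'

/-! ### Block matrices, unipotent groups and the generic character -/

section BlockMatrices

set_option linter.unusedSectionVars false

variable {F : Type*} [Field F]

@[simp] theorem blockEquiv_inl_val {a b n : ℕ} (h : a + b = n) (i : Fin a) :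
    (blockEquiv h (Sum.inl i) : ℕ) = i := by
  simp [blockEquiv]

@[simp] theorem blockEquiv_inr_val {a b n : ℕ} (h : a + b = n) (i : Fin b) :
    (blockEquiv h (Sum.inr i) : ℕ) = a + i := by
  simp [blockEquiv]

/-- The matrix `(A B; C D)` with a square block `A` of size `a` and a square block `D` of
size `b`, indexed by `Fin n` with `n = a + b`. -/
def blockMatrix {a b n : ℕ} (h : a + b = n) (A : Matrix (Fin a) (Fin a) F)
    (B : Matrix (Fin a) (Fin b) F) (C : Matrix (Fin b) (Fin a) F) (D : Matrix (Fin b) (Fin b) F) :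
    Matrix (Fin n) (Fin n) F :=
  Matrix.reindex (blockEquiv h) (blockEquiv h) (Matrix.fromBlocks A B C D)

section
variable {a b n : ℕ} (h : a + b = n) (A A' : Matrix (Fin a) (Fin a) F)
    (B B' : Matrix (Fin a) (Fin b) F) (C C' : Matrix (Fin b) (Fin a) F)
    (D D' : Matrix (Fin b) (Fin b) F)

@[simp] theorem blockMatrix_inl_inl (i j : Fin a) :
    blockMatrix h A B C D (blockEquiv h (.inl i)) (blockEquiv h (.inl j)) = A i j := by
  simp [blockMatrix]
@[simp] theorem blockMatrix_inl_inr (i : Fin a) (j : Fin b) :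
    blockMatrix h A B C D (blockEquiv h (.inl i)) (blockEquiv h (.inr j)) = B i j := by
  simp [blockMatrix]
@[simp] theorem blockMatrix_inr_inl (i : Fin b) (j : Fin a) :
    blockMatrix h A B C D (blockEquiv h (.inr i)) (blockEquiv h (.inl j)) = C i j := by
  simp [blockMatrix]
@[simp] theorem blockMatrix_inr_inr (i j : Fin b) :
    blockMatrix h A B C D (blockEquiv h (.inr i)) (blockEquiv h (.inr j)) = D i j := by
  simp [blockMatrix]

theorem blockMatrix_mul : blockMatrix h A B C D * blockMatrix h A' B' C' D' =
    blockMatrix h (A * A' + B * C') (A * B' + B * D') (C * A' + D * C') (C * B' + D * D') := by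
  simp only [blockMatrix, Matrix.reindex_apply]
  rw [Matrix.submatrix_mul_equiv, Matrix.fromBlocks_multiply]

theorem blockMatrix_one : blockMatrix h (1 : Matrix (Fin a) (Fin a) F) 0 0 1 = 1 := by
  simp [blockMatrix, Matrix.fromBlocks_one]

theorem exists_eq_blockMatrix (M : Matrix (Fin n) (Fin n) F) :
    ∃ A B C D, M = blockMatrix h A B C D := by
  let M' := M.submatrix (blockEquiv h) (blockEquiv h)
  refine ⟨M'.toBlocks₁₁, M'.toBlocks₁₂, M'.toBlocks₂₁, M'.toBlocks₂₂, ?_⟩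
  rw [blockMatrix, Matrix.fromBlocks_toBlocks]
  simp [M']

end

theorem coe_corner {a b n : ℕ} (h : a + b = n) (g : GLn a F) :
    ((corner h g : GLn n F) : Matrix (Fin n) (Fin n) F) = blockMatrix h g.1 0 0 1 := rfl

theorem blockEquiv_rfl_one (n : ℕ) :
    blockEquiv (rfl : n + 1 = n + 1) = finSumFinEquiv := by
  ext x; simp [blockEquiv]

theorem coe_unip {n : ℕ} (y : Fin n → F) :
    ((unip y : GLn (n + 1) F) : Matrix (Fin (n + 1)) (Fin (n + 1)) F)
      = blockMatrix rfl 1 (Matrix.replicateCol (Fin 1) y) 0 1 := by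
  rw [blockMatrix, blockEquiv_rfl_one]; rfl

theorem blockEquiv_inr_zero (n : ℕ) :
    blockEquiv (rfl : n + 1 = n + 1) (Sum.inr 0) = Fin.last n := by
  ext; simp

/-- The matrix `(u z; 0 v)` of size `n = a + b`. -/
def upperBlock {a b n : ℕ} (h : a + b = n) (u : GLn a F) (z : Matrix (Fin a) (Fin b) F)
    (v : GLn b F) : GLn n F where
  val := blockMatrix h u.1 z 0 v.1
  inv := blockMatrix h (u⁻¹).1 (-((u⁻¹).1 * z * (v⁻¹).1)) 0 (v⁻¹).1
  val_inv := by
    rw [blockMatrix_mul, ← blockMatrix_one h]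
    have h1 : u.1 * (u⁻¹).1 = 1 := by rw [← Units.val_mul, mul_inv_cancel, Units.val_one]
    have h2 : v.1 * (v⁻¹).1 = 1 := by rw [← Units.val_mul, mul_inv_cancel, Units.val_one]
    simp only [Matrix.mul_neg, ← Matrix.mul_assoc, h1, h2]
    simp
  inv_val := by
    rw [blockMatrix_mul, ← blockMatrix_one h]
    have h1 : (u⁻¹).1 * u.1 = 1 := by rw [← Units.val_mul, inv_mul_cancel, Units.val_one]
    have h2 : (v⁻¹).1 * v.1 = 1 := by rw [← Units.val_mul, inv_mul_cancel, Units.val_one]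
    simp only [Matrix.neg_mul, Matrix.mul_assoc, h1, h2]
    simp

theorem coe_upperBlock {a b n : ℕ} (h : a + b = n) (u : GLn a F) (z : Matrix (Fin a) (Fin b) F)
    (v : GLn b F) : (upperBlock h u z v).1 = blockMatrix h u.1 z 0 v.1 := rfl

theorem corner_eq_upperBlock {a b n : ℕ} (h : a + b = n) (g : GLn a F) :
    corner h g = upperBlock h g 0 1 := Units.ext rfl

theorem unip_eq_upperBlock {n : ℕ} (y : Fin n → F) :
    unip y = upperBlock rfl 1 (Matrix.replicateCol (Fin 1) y) 1 :=
  Units.ext (coe_unip y)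

theorem upperBlock_mul {a b n : ℕ} (h : a + b = n) (u u' : GLn a F)
    (z z' : Matrix (Fin a) (Fin b) F) (v v' : GLn b F) :
    upperBlock h u z v * upperBlock h u' z' v'
      = upperBlock h (u * u') (u.1 * z' + z * v'.1) (v * v') := by
  apply Units.ext
  rw [Units.val_mul, coe_upperBlock, coe_upperBlock, coe_upperBlock, blockMatrix_mul]
  simp

theorem corner_corner {a b c d n N : ℕ} (h : a + b = n) (h' : n + c = N) (h'' : a + d = N)
    (g : GLn a F) : corner h' (corner h g) = corner h'' g := by
  apply Units.ext
  ext i j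
  have key : ∀ {a b n : ℕ} (h : a + b = n) (g : GLn a F) (i j : Fin n),
      (corner h g).1 i j = if hij : (i : ℕ) < a ∧ (j : ℕ) < a then
        g.1 ⟨i, hij.1⟩ ⟨j, hij.2⟩ else if i = j then 1 else 0 := by
    intro a b n h g i j
    rw [coe_corner]
    obtain ⟨i, rfl⟩ := (blockEquiv h).surjective i
    obtain ⟨j, rfl⟩ := (blockEquiv h).surjective j
    rcases i with i | i <;> rcases j with j | j <;>
      simp [Matrix.one_apply]
  rw [key, key]
  split_ifs <;> first | rfl | omega | skip
  · rw [key]; simp_all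
  · rw [key]; simp_all [Fin.ext_iff]
  · rw [key]; simp_all [Fin.ext_iff]

theorem superdiagSum_upperBlock {a b n : ℕ} (h : a + b = n) (u : GLn a F)
    (z : Matrix (Fin a) (Fin b) F) (v : GLn b F) :
    superdiagSum (upperBlock h u z v) = superdiagSum u + superdiagSum v +
      ∑ i : Fin a, ∑ j : Fin b, if (i : ℕ) + 1 = a + j then z i j else 0 := by
  unfold superdiagSum
  rw [← (blockEquiv h).sum_comp, Fintype.sum_sum_type]
  simp_rw [← (blockEquiv h).sum_comp, Fintype.sum_sum_type, coe_upperBlock]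
  simp only [blockMatrix_inl_inl, blockMatrix_inl_inr, blockMatrix_inr_inl, blockMatrix_inr_inr,
    blockEquiv_inl_val, blockEquiv_inr_val, Finset.sum_add_distrib, Matrix.zero_apply, ite_self,
    Finset.sum_const_zero, zero_add, add_assoc, add_right_inj]
  abel

theorem superdiagSum_one {n : ℕ} : superdiagSum (1 : GLn n F) = 0 := by
  unfold superdiagSum
  refine Finset.sum_eq_zero fun i _ => Finset.sum_eq_zero fun j _ => ?_
  split_ifs with hij
  · rw [Units.val_one, Matrix.one_apply_ne]
    rintro rfl; omega
  · rfl

theorem superdiagSum_corner {a b n : ℕ} (h : a + b = n) (u : GLn a F) :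
    superdiagSum (corner h u) = superdiagSum u := by
  rw [corner_eq_upperBlock, superdiagSum_upperBlock, superdiagSum_one]
  simp

theorem superdiagSum_unip {n : ℕ} (y : Fin (n + 1) → F) :
    superdiagSum (unip y) = y (Fin.last n) := by
  rw [unip_eq_upperBlock, superdiagSum_upperBlock, superdiagSum_one, superdiagSum_one]
  rw [Finset.sum_eq_single (Fin.last n)]
  · simp
  · intro i _ hi
    have : (i : ℕ) ≠ n := fun h => hi (Fin.ext h)
    simp [this]
  · simp

section
variable [Finite F]

theorem mem_unipSubgroup {n k : ℕ} {g : GLn n F} :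
    g ∈ unipSubgroup F n k ↔ ∀ i j : Fin n, (j ≤ i ∨ (j : ℕ) + k < n) →
      g.1 i j = (1 : Matrix (Fin n) (Fin n) F) i j := Iff.rfl

theorem unipSubgroup_le_maxUnip (n k : ℕ) : unipSubgroup F n k ≤ maxUnip F n :=
  fun _ hg i j hij => hg i j (by omega)

theorem upperBlock_mem_maxUnip {a b n : ℕ} (h : a + b = n) {u : GLn a F}
    {z : Matrix (Fin a) (Fin b) F} {v : GLn b F} :
    upperBlock h u z v ∈ maxUnip F n ↔ u ∈ maxUnip F a ∧ v ∈ maxUnip F b := by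
  simp only [mem_unipSubgroup, coe_upperBlock]
  constructor
  · intro H
    constructor
    · intro i j hij
      have := H (blockEquiv h (.inl i)) (blockEquiv h (.inl j))
        (by left; rw [Fin.le_def]; simp; omega)
      simpa [Matrix.one_apply] using this
    · intro i j hij
      have := H (blockEquiv h (.inr i)) (blockEquiv h (.inr j))
        (by left; rw [Fin.le_def]; simp; omega)
      simpa [Matrix.one_apply] using this
  · rintro ⟨hu, hv⟩ i j hij
    obtain ⟨i, rfl⟩ := (blockEquiv h).surjective i
    obtain ⟨j, rfl⟩ := (blockEquiv h).surjective j
    rw [Fin.le_def] at hij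
    rcases i with i | i <;> rcases j with j | j <;> simp at hij
    · simpa [Matrix.one_apply] using hu i j (by rw [Fin.le_def]; omega)
    · omega
    · simp
    · simpa [Matrix.one_apply] using hv i j (by rw [Fin.le_def]; omega)

theorem corner_mem_maxUnip {a b n : ℕ} (h : a + b = n) {u : GLn a F} :
    corner h u ∈ maxUnip F n ↔ u ∈ maxUnip F a := by
  rw [corner_eq_upperBlock, upperBlock_mem_maxUnip]
  simp [one_mem]

theorem unip_mem_maxUnip {n : ℕ} (y : Fin n → F) : unip y ∈ maxUnip F (n + 1) := by
  rw [unip_eq_upperBlock, upperBlock_mem_maxUnip]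
  exact ⟨one_mem _, one_mem _⟩

theorem corner_mem_unipSubgroup {n k : ℕ} {u : GLn n F} (hu : u ∈ unipSubgroup F n k) :
    corner (rfl : n + 1 = n + 1) u ∈ unipSubgroup F (n + 1) (k + 1) := by
  intro i j hij
  rw [coe_corner]
  obtain ⟨i, rfl⟩ := (blockEquiv rfl).surjective i
  obtain ⟨j, rfl⟩ := (blockEquiv rfl).surjective j
  rw [Fin.le_def] at hij
  rcases i with i | i <;> rcases j with j | j <;> simp at hij
  · simpa [Matrix.one_apply] using hu i j (by rw [Fin.le_def]; omega)
  · omega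
  · simp
  · simp [Matrix.one_apply]

theorem unip_mem_unipSubgroup {n : ℕ} (k : ℕ) (y : Fin n → F) :
    unip y ∈ unipSubgroup F (n + 1) (k + 1) := by
  intro i j hij
  rw [coe_unip]
  obtain ⟨i, rfl⟩ := (blockEquiv rfl).surjective i
  obtain ⟨j, rfl⟩ := (blockEquiv rfl).surjective j
  rw [Fin.le_def] at hij
  rcases i with i | i <;> rcases j with j | j <;> simp at hij
  · simp [Matrix.one_apply]
  · omega
  · simp
  · simp [Matrix.one_apply]

theorem maxUnip_le_mirabolic (n : ℕ) : maxUnip F (n + 1) ≤ mirabolic F n := by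
  intro g hg
  change g.1 (Fin.last n) = _
  ext j
  rw [hg _ _ (Or.inl (Fin.le_last j))]
  simp [Matrix.one_apply, Pi.single_apply, eq_comm]

/-- The sum of the superdiagonal entries is a homomorphism on `N_n`. -/
theorem superdiagSum_mul {n : ℕ} {u v : GLn n F} (hu : u ∈ maxUnip F n) (hv : v ∈ maxUnip F n) :
    superdiagSum (u * v) = superdiagSum u + superdiagSum v := by
  unfold superdiagSum
  simp_rw [← Finset.sum_add_distrib]
  refine Finset.sum_congr rfl fun i _ => Finset.sum_congr rfl fun j _ => ?_
  split_ifs with hij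
  · have hne : i ≠ j := by rintro rfl; omega
    rw [Units.val_mul, Matrix.mul_apply, Finset.sum_eq_add i j hne]
    · rw [hu i i (by simp), hv j j (by simp)]
      simp [add_comm]
    · intro l _ hl
      rcases lt_or_gt_of_ne hl.1 with h1 | h1
      · rw [hu i l (Or.inl h1.le), Matrix.one_apply_ne h1.ne', zero_mul]
      · have h2 : j < l := by
          refine lt_of_le_of_ne ?_ hl.2.symm
          rw [Fin.le_def, ← hij]; exact h1
        rw [hv l j (Or.inl h2.le), Matrix.one_apply_ne h2.ne', mul_zero]
    · simp
    · simp
  · simp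

end

/-- Every element of `P_{n+1}` is `(g y; 0 1) = (1 y; 0 1) (g 0; 0 1)`. -/
theorem exists_eq_unip_mul_corner {n : ℕ} {p : GLn (n + 1) F} (hp : p ∈ mirabolic F n) :
    ∃ (y : Fin n → F) (g : GLn n F), p = unip y * corner rfl g := by
  have hform : ∀ q ∈ mirabolic F n, ∃ A B, q.1 = blockMatrix (rfl : n + 1 = n + 1) A B 0 1 := by
    intro q hq
    obtain ⟨A, B, C, D, h⟩ := exists_eq_blockMatrix (rfl : n + 1 = n + 1) q.1
    have hq : q.1 (Fin.last n) = Pi.single (Fin.last n) 1 := hq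
    have hC : C = 0 := by
      ext i j
      have h1 := congrFun hq (blockEquiv rfl (.inl j))
      rw [← blockEquiv_inr_zero, h, blockMatrix_inr_inl, Pi.single_apply, if_neg (by simp)] at h1
      rw [Subsingleton.elim i 0, h1]; rfl
    have hD : D = 1 := by
      ext i j
      have h1 := congrFun hq (blockEquiv rfl (.inr j))
      rw [Subsingleton.elim j 0] at h1 ⊢
      rw [← blockEquiv_inr_zero, h, blockMatrix_inr_inr, Pi.single_apply, if_pos rfl] at h1
      rw [Subsingleton.elim i 0, h1]; rfl
    exact ⟨A, B, by rw [h, hC, hD]⟩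
  obtain ⟨A, B, h⟩ := hform p hp
  obtain ⟨A', B', h'⟩ := hform p⁻¹ (inv_mem hp)
  have hinj : ∀ {A A' : Matrix (Fin n) (Fin n) F} {B B'},
      blockMatrix (rfl : n + 1 = n + 1) A B 0 1 = blockMatrix rfl A' B' 0 1 → A = A' := by
    intro A A' B B' h
    ext i j
    have := congrFun (congrFun h (blockEquiv rfl (.inl i))) (blockEquiv rfl (.inl j))
    simpa using this
  have h1 : A * A' = 1 := by
    have : p.1 * (p⁻¹).1 = 1 := by rw [← Units.val_mul, mul_inv_cancel, Units.val_one]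
    rw [h, h', blockMatrix_mul, ← blockMatrix_one rfl] at this
    refine (Eq.trans ?_ (hinj (by simpa using this)))
    simp
  have h2 : A' * A = 1 := by
    have : (p⁻¹).1 * p.1 = 1 := by rw [← Units.val_mul, inv_mul_cancel, Units.val_one]
    rw [h, h', blockMatrix_mul, ← blockMatrix_one rfl] at this
    refine (Eq.trans ?_ (hinj (by simpa using this)))
    simp
  refine ⟨fun i => B i 0, ⟨A, A', h1, h2⟩, Units.ext ?_⟩
  rw [Units.val_mul, coe_unip, coe_corner, blockMatrix_mul, h]
  congr 1
  · simp
  · ext i j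
    simp [Subsingleton.elim j 0]
  · simp
  · simp

theorem exists_eq_unip_mul_corner_of_mem_maxUnip [Finite F] {n : ℕ} {u : GLn (n + 1) F}
    (hu : u ∈ maxUnip F (n + 1)) :
    ∃ (y : Fin n → F) (g : GLn n F), g ∈ maxUnip F n ∧ u = unip y * corner rfl g := by
  obtain ⟨y, g, rfl⟩ := exists_eq_unip_mul_corner (maxUnip_le_mirabolic n hu)
  refine ⟨y, g, ?_, rfl⟩
  rwa [Subgroup.mul_mem_cancel_left _ (unip_mem_maxUnip y), corner_mem_maxUnip] at hu

/-- `GL_n` acts transitively on nonzero row vectors. -/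
theorem exists_vecMul_eq {n : ℕ} {b c : Fin n → F} (hb : b ≠ 0) (hc : c ≠ 0) :
    ∃ g : GLn n F, Matrix.vecMul b g.1 = c := by
  obtain ⟨g, hg⟩ := Submodule.exists_linearEquiv_restrict_eq
    ((LinearEquiv.toSpanNonzeroSingleton F _ b hb).symm ≪≫ₗ
      LinearEquiv.toSpanNonzeroSingleton F _ c hc)
  have hgb : g b = c := by
    have := hg ⟨b, Submodule.mem_span_singleton_self b⟩
    have h1 : (LinearEquiv.toSpanNonzeroSingleton F _ b hb).symm
        ⟨b, Submodule.mem_span_singleton_self b⟩ = 1 := by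
      rw [LinearEquiv.symm_apply_eq, LinearEquiv.toSpanNonzeroSingleton_one]
    rw [LinearEquiv.trans_apply, h1, LinearEquiv.toSpanNonzeroSingleton_one] at this
    exact this.symm
  refine ⟨⟨(LinearMap.toMatrix' g.toLinearMap).transpose,
    (LinearMap.toMatrix' g.symm.toLinearMap).transpose, ?_, ?_⟩, ?_⟩
  · rw [← Matrix.transpose_mul, ← LinearMap.toMatrix'_comp]; simp
  · rw [← Matrix.transpose_mul, ← LinearMap.toMatrix'_comp]; simp
  · simp only [Matrix.vecMul_transpose]
    rw [LinearMap.toMatrix'_mulVec]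
    exact hgb

end BlockMatrices

/-! ### Fourier analysis on the unipotent radical of the mirabolic subgroup -/

section Fourier

set_option linter.unusedSectionVars false

variable {F : Type*} [Field F] [Fintype F] {R : Type u} [CommRing R]

/-- The conditions on an additive character under which Fourier analysis on `F`-vector spaces
works over `R`: the number of elements of `F` is invertible, and `ψ` sums to zero over `F`. The
second condition is what nontriviality becomes when `R` may have zero divisors. -/
structure IsFourierChar (ψ : AddChar F R) : Prop where
  isUnit_card : IsUnit (Fintype.card F : R)
  sum_eq_zero : ∑ x, ψ x = 0

variable {ψ : AddChar F R}

theorem IsFourierChar.inv (hψ : IsFourierChar ψ) : IsFourierChar ψ⁻¹ where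
  isUnit_card := hψ.isUnit_card
  sum_eq_zero := by
    rw [← hψ.sum_eq_zero, ← Equiv.sum_comp (Equiv.neg F) fun x => ψ x]
    simp [AddChar.inv_apply]

theorem IsFourierChar.sum_mul_eq_zero (hψ : IsFourierChar ψ) {a : F} (ha : a ≠ 0) :
    ∑ x, ψ (a * x) = 0 := by
  rw [← hψ.sum_eq_zero]
  exact Equiv.sum_comp (Equiv.mulLeft₀ a ha) fun x => ψ x

theorem IsFourierChar.sum_dotProduct_eq_zero (hψ : IsFourierChar ψ) {d : ℕ} {b : Fin d → F}
    (hb : b ≠ 0) : ∑ y : Fin d → F, ψ (b ⬝ᵥ y) = 0 := by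
  classical
  obtain ⟨i, hi⟩ := Function.ne_iff.mp hb
  have h1 : ∀ y : Fin d → F, ψ (b ⬝ᵥ y) = ∏ i, ψ (b i * y i) := fun y =>
    map_prod ψ.toMonoidHom (fun i => Multiplicative.ofAdd (b i * y i)) Finset.univ
  simp_rw [h1]
  rw [← Fintype.prod_sum fun i x => ψ (b i * x)]
  exact Finset.prod_eq_zero (Finset.mem_univ i) (hψ.sum_mul_eq_zero hi)

theorem unipP_mul {n : ℕ} (y z : Fin n → F) : unipP y * unipP z = unipP (y + z) :=
  Subtype.ext (Units.ext (unipMatrix_mul y z))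

theorem unipP_zero {n : ℕ} : unipP (0 : Fin n → F) = 1 :=
  Subtype.ext (Units.ext unipMatrix_zero)

/-- `z` is an eigenvector of `U_{d+1}` with the character `y ↦ ψ(b ⬝ y)`. -/
def IsEigen (ψ : AddChar F R) {d : ℕ} (Z : Rep.{v} R (mirabolic F d)) (b : Fin d → F)
    (z : Z.V) : Prop :=
  ∀ y, Z.ρ (unipP y) z = ψ (b ⬝ᵥ y) • z

/-- The idempotent `q^{-d} ∑_y ψ(-b ⬝ y) ρ(y)` that projects a representation of `P_{d+1}` onto
the eigenspace of `U_{d+1}` with the character `y ↦ ψ(b ⬝ y)`. -/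
def avg (ψ : AddChar F R) {d : ℕ} (Z : Rep.{v} R (mirabolic F d)) (b : Fin d → F) :
    Z.V →ₗ[R] Z.V :=
  (Ring.inverse (Fintype.card F : R) ^ d) •
    ∑ y : Fin d → F, ψ (-(b ⬝ᵥ y)) • Z.ρ (unipP y)

variable {d : ℕ} {Z : Rep.{v} R (mirabolic F d)}

theorem avg_apply (b : Fin d → F) (z : Z.V) : avg ψ Z b z =
    (Ring.inverse (Fintype.card F : R) ^ d) •
      ∑ y : Fin d → F, ψ (-(b ⬝ᵥ y)) • Z.ρ (unipP y) z := by
  simp [avg, LinearMap.sum_apply]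

theorem isEigen_avg (b : Fin d → F) (z : Z.V) : IsEigen ψ Z b (avg ψ Z b z) := by
  intro y
  rw [avg_apply, map_smul, map_sum, smul_comm (ψ _) (_ ^ d), Finset.smul_sum (r := ψ _)]
  congr 1
  rw [← Equiv.sum_comp (Equiv.addLeft y) fun x => ψ (b ⬝ᵥ y) • ψ (-(b ⬝ᵥ x)) • Z.ρ (unipP x) z]
  refine Finset.sum_congr rfl fun x _ => ?_
  rw [map_smul, ← Module.End.mul_apply, ← map_mul, unipP_mul, Equiv.coe_addLeft, smul_smul,
    ← AddChar.map_add_eq_mul, dotProduct_add]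
  congr 2
  ring

theorem IsFourierChar.card_inv_mul (hψ : IsFourierChar ψ) (d : ℕ) :
    Ring.inverse (Fintype.card F : R) ^ d * (Fintype.card (Fin d → F) : R) = 1 := by
  rw [Fintype.card_fun, Fintype.card_fin, Nat.cast_pow, ← mul_pow,
    Ring.inverse_mul_cancel _ hψ.isUnit_card, one_pow]

theorem avg_of_isEigen (hψ : IsFourierChar ψ) {b : Fin d → F} {z : Z.V} (hz : IsEigen ψ Z b z) :
    avg ψ Z b z = z := by
  rw [avg_apply]
  have : ∀ y : Fin d → F, ψ (-(b ⬝ᵥ y)) • Z.ρ (unipP y) z = z := by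
    intro y
    rw [hz y, smul_smul, ← AddChar.map_add_eq_mul, neg_add_cancel, AddChar.map_zero_eq_one,
      one_smul]
  simp_rw [this]
  rw [Finset.sum_const, Finset.card_univ, ← Nat.cast_smul_eq_nsmul R, smul_smul,
    hψ.card_inv_mul, one_smul]

theorem sum_avg (hψ : IsFourierChar ψ) (z : Z.V) : ∑ b, avg ψ Z b z = z := by
  simp_rw [avg_apply]
  rw [← Finset.smul_sum, Finset.sum_comm]
  simp_rw [← Finset.sum_smul]
  rw [Finset.sum_eq_single 0]
  · simp only [dotProduct_zero, neg_zero, AddChar.map_zero_eq_one, unipP_zero, map_one]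
    rw [Finset.sum_const, Finset.card_univ, nsmul_eq_mul, mul_one, smul_smul,
      hψ.card_inv_mul, one_smul]; rfl
  · intro y _ hy
    have := hψ.sum_dotProduct_eq_zero (neg_ne_zero.mpr hy)
    rw [show ∑ b : Fin d → F, ψ (-(b ⬝ᵥ y)) = 0 from ?_, zero_smul]
    rw [← this]
    refine Finset.sum_congr rfl fun b _ => ?_
    rw [neg_dotProduct, dotProduct_comm]
  · simp

theorem avg_mem_coinvKer {b : Fin d → F} {z : Z.V}
    (hz : z ∈ coinvKer Z fun y => ψ (b ⬝ᵥ y)) : avg ψ Z b z = 0 := by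
  refine (Submodule.span_le (p := LinearMap.ker (avg ψ Z b))).mpr ?_ hz
  rintro _ ⟨y, x, rfl⟩
  rw [SetLike.mem_coe, LinearMap.mem_ker, map_sub, map_smul, sub_eq_zero, avg_apply, avg_apply,
    smul_comm (ψ _) (_ ^ d), Finset.smul_sum (r := ψ _)]
  congr 1
  rw [← Equiv.sum_comp (Equiv.addRight y) fun w => ψ (b ⬝ᵥ y) • ψ (-(b ⬝ᵥ w)) • Z.ρ (unipP w) x]
  refine Finset.sum_congr rfl fun w _ => ?_
  rw [← Module.End.mul_apply, ← map_mul, unipP_mul, Equiv.coe_addRight, smul_smul,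
    ← AddChar.map_add_eq_mul, dotProduct_add]
  congr 2
  ring

theorem sub_avg_mem_coinvKer (hψ : IsFourierChar ψ) (b : Fin d → F) (z : Z.V) :
    z - avg ψ Z b z ∈ coinvKer Z fun y => ψ (b ⬝ᵥ y) := by
  rw [← Submodule.Quotient.mk_eq_zero, Submodule.Quotient.mk_sub, sub_eq_zero, avg_apply,
    Submodule.Quotient.mk_smul, ← Submodule.mkQ_apply, ← Submodule.mkQ_apply, map_sum]
  have : ∀ y : Fin d → F, (coinvKer Z fun y => ψ (b ⬝ᵥ y)).mkQ
      (ψ (-(b ⬝ᵥ y)) • Z.ρ (unipP y) z) = (coinvKer Z fun y => ψ (b ⬝ᵥ y)).mkQ z := by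
    intro y
    have h : (coinvKer Z fun y => ψ (b ⬝ᵥ y)).mkQ (Z.ρ (unipP y) z) =
        ψ (b ⬝ᵥ y) • (coinvKer Z fun y => ψ (b ⬝ᵥ y)).mkQ z := by
      rw [← map_smul, ← sub_eq_zero, ← map_sub, Submodule.mkQ_apply,
        Submodule.Quotient.mk_eq_zero]
      exact Submodule.subset_span ⟨y, z, rfl⟩
    rw [map_smul, h, smul_smul, ← AddChar.map_add_eq_mul, neg_add_cancel,
      AddChar.map_zero_eq_one, one_smul]
  simp_rw [this]
  rw [Finset.sum_const, Finset.card_univ, ← Nat.cast_smul_eq_nsmul R, smul_smul,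
    hψ.card_inv_mul, one_smul]

theorem IsEigen.cornerP {b c : Fin d → F} {z : Z.V} (hz : IsEigen ψ Z b z) (g : GLn d F)
    (hg : Matrix.vecMul c g.1 = b) : IsEigen ψ Z c (Z.ρ (FiniteGL.cornerP g) z) := by
  intro y
  have h1 : unipP y * FiniteGL.cornerP g =
      FiniteGL.cornerP g * unipP (Matrix.mulVec (g⁻¹).1 y) := by
    rw [cornerP_mul_unipP, Matrix.mulVec_mulVec, ← Units.val_mul, mul_inv_cancel]
    simp
  rw [← Module.End.mul_apply, ← map_mul, h1, map_mul, Module.End.mul_apply, hz, map_smul, ← hg,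
    Matrix.dotProduct_mulVec, Matrix.vecMul_vecMul, ← Units.val_mul, mul_inv_cancel]
  simp

end Fourier

/-! ### The functor `Φ⁻` and Whittaker vectors -/

section WhittakerVectors

set_option linter.unusedSectionVars false

variable {F : Type*} [Field F] {R : Type u} [CommRing R]

variable (F) in
/-- The row vector `(0, …, 0, 1)`. -/
def lastCovector (d : ℕ) : Fin (d + 1) → F := Pi.single (Fin.last d) 1

theorem lastCovector_dotProduct {d : ℕ} (y : Fin (d + 1) → F) :
    lastCovector F d ⬝ᵥ y = y (Fin.last d) := by
  simp [lastCovector]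

theorem lastCovector_ne_zero {d : ℕ} : lastCovector F d ≠ 0 := by
  simp [lastCovector]

/-- The quotient map `Z → Φ⁻ Z`. -/
def phiMk (ψ : AddChar F R) {d : ℕ} (Z : Rep.{v} R (mirabolic F (d + 1))) :
    Z.V →ₗ[R] (phiMinus ψ Z).V :=
  (coinvKer Z fun y => ψ (y (Fin.last d))).mkQ

section
variable (ψ : AddChar F R) {d : ℕ} (Z : Rep.{v} R (mirabolic F (d + 1)))

theorem phiMk_surjective : Function.Surjective (phiMk ψ Z) := Submodule.mkQ_surjective _

theorem ker_phiMk : LinearMap.ker (phiMk ψ Z) =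
    coinvKer Z fun y => ψ (lastCovector F d ⬝ᵥ y) := by
  simp_rw [lastCovector_dotProduct]
  exact Submodule.ker_mkQ _

theorem phiMk_cornerP (g : mirabolic F d) (z : Z.V) :
    phiMk ψ Z (Z.ρ (cornerP g.1) z) = (phiMinus ψ Z).ρ g (phiMk ψ Z z) := rfl

theorem phiMk_unipP (y : Fin (d + 1) → F) (z : Z.V) :
    phiMk ψ Z (Z.ρ (unipP y) z) = ψ (y (Fin.last d)) • phiMk ψ Z z := by
  rw [← map_smul, ← sub_eq_zero, ← map_sub, ← LinearMap.mem_ker]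
  rw [ker_phiMk]
  simp_rw [lastCovector_dotProduct]
  exact Submodule.subset_span ⟨y, z, rfl⟩

end

variable [Fintype F]

section
variable {ψ : AddChar F R} {d : ℕ} {Z : Rep.{v} R (mirabolic F (d + 1))}

theorem phiMk_avg (hψ : IsFourierChar ψ) (z : Z.V) :
    phiMk ψ Z (avg ψ Z (lastCovector F d) z) = phiMk ψ Z z := by
  rw [eq_comm, ← sub_eq_zero, ← map_sub, ← LinearMap.mem_ker, ker_phiMk]
  exact sub_avg_mem_coinvKer hψ _ z

theorem eq_zero_of_phiMk_eq_zero (hψ : IsFourierChar ψ) {z : Z.V}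
    (hz : IsEigen ψ Z (lastCovector F d) z) (h : phiMk ψ Z z = 0) : z = 0 := by
  rw [← avg_of_isEigen hψ hz]
  rw [← LinearMap.mem_ker, ker_phiMk] at h
  exact avg_mem_coinvKer h

theorem exists_isEigen_phiMk_eq (hψ : IsFourierChar ψ) (x : (phiMinus ψ Z).V) :
    ∃ z, IsEigen ψ Z (lastCovector F d) z ∧ phiMk ψ Z z = x := by
  obtain ⟨z, rfl⟩ := phiMk_surjective ψ Z x
  exact ⟨avg ψ Z (lastCovector F d) z, isEigen_avg _ _, phiMk_avg hψ z⟩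

theorem lastCovector_vecMul (g : mirabolic F d) :
    Matrix.vecMul (lastCovector F d) g.1.1 = lastCovector F d := by
  rw [lastCovector, Matrix.single_one_vecMul]
  exact g.2

theorem IsEigen.cornerP_mirabolic {z : Z.V} (hz : IsEigen ψ Z (lastCovector F d) z)
    (g : mirabolic F d) : IsEigen ψ Z (lastCovector F d) (Z.ρ (FiniteGL.cornerP g.1) z) :=
  hz.cornerP g.1 (lastCovector_vecMul g)

theorem avg_cornerP (hψ : IsFourierChar ψ) (g : mirabolic F d) (z : Z.V) :
    avg ψ Z (lastCovector F d) (Z.ρ (cornerP g.1) z)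
      = Z.ρ (cornerP g.1) (avg ψ Z (lastCovector F d) z) := by
  rw [← sub_eq_zero]
  refine eq_zero_of_phiMk_eq_zero hψ (fun y => ?_) ?_
  · rw [map_sub, isEigen_avg, (isEigen_avg _ z).cornerP_mirabolic g, smul_sub]
  · rw [map_sub, phiMk_avg hψ, phiMk_cornerP, phiMk_cornerP, phiMk_avg hψ, sub_self]

end

/-- An element of `N_{d+1}`, viewed in `P_{d+1}`. -/
def maxUnipP {d : ℕ} (u : maxUnip F (d + 1)) : mirabolic F d :=
  ⟨u.1, maxUnip_le_mirabolic d u.2⟩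

/-- `z` is a Whittaker vector: an eigenvector of `N_{d+1}` with the character `ψ`. -/
def IsWhittakerVector (ψ : AddChar F R) {d : ℕ} (Z : Rep.{v} R (mirabolic F d)) (z : Z.V) :
    Prop :=
  ∀ u : maxUnip F (d + 1), Z.ρ (maxUnipP u) z = ψ (superdiagSum u.1) • z

/-- The submodule `Z(N_{d+1}, ψ)` generated by the elements `u z - ψ(u) z`. -/
def whittakerKer (ψ : AddChar F R) {d : ℕ} (Z : Rep.{v} R (mirabolic F d)) : Submodule R Z.V :=
  Submodule.span R {w | ∃ (u : maxUnip F (d + 1)) (x : Z.V),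
    w = Z.ρ (maxUnipP u) x - ψ (superdiagSum u.1) • x}

theorem maxUnip_one_eq_one (u : maxUnip F 1) : u = 1 := by
  apply Subtype.ext
  apply Units.ext
  ext i j
  exact u.2 i j (Or.inl (by rw [Subsingleton.elim i j]))

theorem isWhittakerVector_zero {ψ : AddChar F R} {Z : Rep.{v} R (mirabolic F 0)} (z : Z.V) :
    IsWhittakerVector ψ Z z := by
  intro u
  rw [maxUnip_one_eq_one u]
  have : maxUnipP (1 : maxUnip F 1) = 1 := rfl
  rw [this]
  simp [superdiagSum_one]

theorem whittakerKer_zero {ψ : AddChar F R} {Z : Rep.{v} R (mirabolic F 0)} :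
    whittakerKer ψ Z = ⊥ := by
  rw [whittakerKer, Submodule.span_eq_bot]
  rintro _ ⟨u, z, rfl⟩
  rw [sub_eq_zero]
  exact isWhittakerVector_zero z u

section
variable {ψ : AddChar F R} {d : ℕ} {Z : Rep.{v} R (mirabolic F (d + 1))}

/-- Every element of `N_{d+2}` is `(1 y; 0 1) (u 0; 0 1)` with `u ∈ N_{d+1}`. -/
theorem exists_maxUnipP_eq (u : maxUnip F (d + 2)) : ∃ (y : Fin (d + 1) → F)
    (u' : maxUnip F (d + 1)), maxUnipP u = unipP y * cornerP (maxUnipP u').1 ∧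
      superdiagSum u.1 = y (Fin.last d) + superdiagSum u'.1 := by
  obtain ⟨u, hu⟩ := u
  obtain ⟨y, u', hu', rfl⟩ := exists_eq_unip_mul_corner_of_mem_maxUnip hu
  refine ⟨y, ⟨u', hu'⟩, rfl, ?_⟩
  rw [superdiagSum_mul (unip_mem_maxUnip y) ((corner_mem_maxUnip _).mpr hu'), superdiagSum_unip,
    superdiagSum_corner]

theorem isWhittakerVector_succ (hψ : IsFourierChar ψ) {z : Z.V} : IsWhittakerVector ψ Z z ↔
    IsEigen ψ Z (lastCovector F d) z ∧ IsWhittakerVector ψ (phiMinus ψ Z) (phiMk ψ Z z) := by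
  constructor
  · intro hz
    refine ⟨fun y => ?_, fun u => ?_⟩
    · have := hz ⟨unip y, unip_mem_maxUnip y⟩
      rwa [superdiagSum_unip, ← lastCovector_dotProduct y] at this
    · have := hz ⟨corner rfl u.1, (corner_mem_maxUnip _).mpr u.2⟩
      rw [superdiagSum_corner] at this
      rw [← phiMk_cornerP, ← map_smul, ← this]
      rfl
  · rintro ⟨h1, h2⟩ u
    obtain ⟨y, u', hu, hs⟩ := exists_maxUnipP_eq u
    have h3 : Z.ρ (cornerP (maxUnipP u').1) z = ψ (superdiagSum u'.1) • z := by
      rw [← sub_eq_zero]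
      refine eq_zero_of_phiMk_eq_zero hψ (fun y => ?_) ?_
      · rw [map_sub, map_smul, h1.cornerP_mirabolic, h1, smul_sub, smul_comm]
      · rw [map_sub, map_smul, phiMk_cornerP, h2, sub_self]
    rw [hu, map_mul, Module.End.mul_apply, h3, map_smul, h1, hs, AddChar.map_add_eq_mul,
      smul_smul, mul_comm, lastCovector_dotProduct]

theorem comap_phiMk_whittakerKer :
    (whittakerKer ψ (phiMinus ψ Z)).comap (phiMk ψ Z) = whittakerKer ψ Z := by
  apply le_antisymm
  · have h1 : whittakerKer ψ (phiMinus ψ Z) ≤ (whittakerKer ψ Z).map (phiMk ψ Z) := by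
      refine Submodule.span_le.mpr ?_
      rintro _ ⟨u, x, rfl⟩
      obtain ⟨x, rfl⟩ := phiMk_surjective ψ Z x
      refine ⟨_, Submodule.subset_span
        ⟨⟨corner rfl u.1, (corner_mem_maxUnip _).mpr u.2⟩, x, rfl⟩, ?_⟩
      rw [map_sub, map_smul, superdiagSum_corner, ← phiMk_cornerP]
      rfl
    refine (Submodule.comap_mono h1).trans ?_
    rw [Submodule.comap_map_eq, sup_le_iff]
    refine ⟨le_rfl, ?_⟩
    rw [ker_phiMk]
    refine Submodule.span_le.mpr ?_
    rintro _ ⟨y, x, rfl⟩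
    refine Submodule.subset_span ⟨⟨unip y, unip_mem_maxUnip y⟩, x, ?_⟩
    rw [superdiagSum_unip, ← lastCovector_dotProduct y]
    rfl
  · refine Submodule.span_le.mpr ?_
    rintro _ ⟨u, x, rfl⟩
    obtain ⟨y, u', hu, hs⟩ := exists_maxUnipP_eq u
    rw [SetLike.mem_coe, Submodule.mem_comap, hu, map_sub, map_mul, Module.End.mul_apply,
      phiMk_unipP, phiMk_cornerP, map_smul, hs, AddChar.map_add_eq_mul, mul_smul, ← smul_sub]
    exact Submodule.smul_mem _ _ (Submodule.subset_span ⟨u', _, rfl⟩)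

end

variable {ψ : AddChar F R}

theorem IsWhittakerVector.sub {d : ℕ} {Z : Rep.{v} R (mirabolic F d)} {z z' : Z.V}
    (hz : IsWhittakerVector ψ Z z) (hz' : IsWhittakerVector ψ Z z') :
    IsWhittakerVector ψ Z (z - z') := fun u => by
  rw [map_sub, hz u, hz' u, smul_sub]

theorem IsWhittakerVector.smul {d : ℕ} {Z : Rep.{v} R (mirabolic F d)} {z : Z.V}
    (hz : IsWhittakerVector ψ Z z) (c : R) : IsWhittakerVector ψ Z (c • z) := fun u => by
  rw [map_smul, hz u, smul_comm]

theorem IsWhittakerVector.eq_zero (hψ : IsFourierChar ψ) {d : ℕ} {Z : Rep.{v} R (mirabolic F d)}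
    {z : Z.V} (hz : IsWhittakerVector ψ Z z) (hz' : z ∈ whittakerKer ψ Z) : z = 0 := by
  induction d with
  | zero => rwa [whittakerKer_zero, Submodule.mem_bot] at hz'
  | succ d ih =>
    rw [isWhittakerVector_succ hψ] at hz
    rw [← comap_phiMk_whittakerKer] at hz'
    exact eq_zero_of_phiMk_eq_zero hψ hz.1 (ih hz.2 hz')

/-- Every vector is congruent to a Whittaker vector modulo `Z(N_{d+1}, ψ)`. -/
theorem exists_isWhittakerVector (hψ : IsFourierChar ψ) {d : ℕ} {Z : Rep.{v} R (mirabolic F d)}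
    (z : Z.V) : ∃ z₀, IsWhittakerVector ψ Z z₀ ∧ z - z₀ ∈ whittakerKer ψ Z := by
  induction d with
  | zero => exact ⟨z, isWhittakerVector_zero z, by simp⟩
  | succ d ih =>
    obtain ⟨x, hx, hx'⟩ := ih (phiMk ψ Z z)
    obtain ⟨z₀, hz₀, rfl⟩ := exists_isEigen_phiMk_eq hψ x
    refine ⟨z₀, (isWhittakerVector_succ hψ).mpr ⟨hz₀, hx⟩, ?_⟩
    rwa [← comap_phiMk_whittakerKer, Submodule.mem_comap, map_sub]

theorem phiMinusIterMk_succ {t k : ℕ} (Z : Rep.{v} R (mirabolic F (t + (k + 1)))) :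
    phiMinusIterMk ψ (k + 1) Z = phiMinusIterMk ψ k (phiMinus ψ (n := t + k) Z) ∘ₗ
      phiMk (d := t + k) ψ Z := rfl

theorem phiMinusIterMk_surjective {t : ℕ} (k : ℕ) (Z : Rep.{v} R (mirabolic F (t + k))) :
    Function.Surjective (phiMinusIterMk ψ k Z) := by
  induction k with
  | zero => exact Function.surjective_id
  | succ k ih =>
    rw [phiMinusIterMk_succ]
    exact (ih _).comp (phiMk_surjective (d := t + k) ψ Z)

theorem ker_phiMinusIterMk (k : ℕ) (Z : Rep.{v} R (mirabolic F (0 + k))) :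
    LinearMap.ker (phiMinusIterMk ψ k Z) = whittakerKer ψ Z := by
  induction k with
  | zero =>
    refine Eq.trans ?_ (whittakerKer_zero (Z := Z)).symm
    exact LinearMap.ker_id
  | succ k ih =>
    refine Eq.trans ?_ (comap_phiMk_whittakerKer (d := 0 + k) (Z := Z))
    rw [← ih]
    rfl

/-- Whittaker vectors lift along `Z → (Φ⁻)^k Z`. -/
theorem exists_isWhittakerVector_phiMinusIterMk_eq (hψ : IsFourierChar ψ) {t : ℕ} (k : ℕ)
    (Z : Rep.{v} R (mirabolic F (t + k))) (x : (phiMinusIter ψ k Z).V)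
    (hx : IsWhittakerVector ψ (phiMinusIter ψ k Z) x) :
    ∃ z, IsWhittakerVector ψ Z z ∧ phiMinusIterMk ψ k Z z = x := by
  induction k with
  | zero => exact ⟨x, hx, rfl⟩
  | succ k ih =>
    obtain ⟨y, hy, hyx⟩ := ih (phiMinus ψ (n := t + k) Z) x hx
    obtain ⟨z, hz, hzy⟩ := exists_isEigen_phiMk_eq (d := t + k) (Z := Z) hψ y
    refine ⟨z, (isWhittakerVector_succ (d := t + k) hψ).mpr ⟨hz, by rwa [hzy]⟩, ?_⟩
    rw [← hyx, ← hzy]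
    rfl

end WhittakerVectors

/-! ### Vanishing of invariant bilinear forms -/

section Vanishing

variable {F : Type*} [Field F] {R : Type u} [CommRing R]

set_option linter.unusedSectionVars false

/-- A `GL_d`-invariant form on `X × Y` that is also invariant under `U_{d+1}` in the first
variable factors through `Ψ⁻ X`. -/
theorem eq_zero_of_invariantForms_psiMinus {d : ℕ} {X : Rep.{v} R (mirabolic F d)}
    {Y : Rep.{w} R (GLn d F)} (h : invariantForms (psiMinus X) Y = ⊥)
    (B : X.V →ₗ[R] Y.V →ₗ[R] R)
    (hB : ∀ g x y, B (X.ρ (cornerP g) x) (Y.ρ g y) = B x y)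
    (hU : ∀ u x y, B (X.ρ (unipP u) x) y = B x y) : B = 0 := by
  have hker : coinvKer X (fun _ => 1) ≤ LinearMap.ker B := by
    refine Submodule.span_le.mpr ?_
    rintro _ ⟨u, x, rfl⟩
    rw [SetLike.mem_coe, LinearMap.mem_ker, one_smul, map_sub, sub_eq_zero]
    exact LinearMap.ext (hU u x)
  let B₀ : (psiMinus X).V →ₗ[R] Y.V →ₗ[R] R := (coinvKer X fun _ => 1).liftQ B hker
  have hmem : B₀ ∈ invariantForms (psiMinus X) Y := by
    intro g x y
    obtain ⟨x, rfl⟩ := Submodule.mkQ_surjective _ x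
    exact hB g x y
  rw [h, Submodule.mem_bot] at hmem
  ext x y
  exact LinearMap.congr_fun (LinearMap.congr_fun hmem
    ((coinvKer X fun _ => 1).mkQ x)) y

theorem eq_zero_of_invariantForms_psiMinus_psiMinus {d : ℕ} {X : Rep.{v} R (mirabolic F d)}
    {Y : Rep.{w} R (mirabolic F d)} (h : invariantForms (psiMinus X) (psiMinus Y) = ⊥)
    (B : X.V →ₗ[R] Y.V →ₗ[R] R)
    (hB : ∀ g x y, B (X.ρ (cornerP g) x) (Y.ρ (cornerP g) y) = B x y)
    (hU : ∀ u x y, B (X.ρ (unipP u) x) y = B x y)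
    (hU' : ∀ u x y, B x (Y.ρ (unipP u) y) = B x y) : B = 0 := by
  have hker : coinvKer Y (fun _ => 1) ≤ LinearMap.ker B.flip := by
    refine Submodule.span_le.mpr ?_
    rintro _ ⟨u, y, rfl⟩
    rw [SetLike.mem_coe, LinearMap.mem_ker, one_smul, map_sub, sub_eq_zero]
    exact LinearMap.ext fun x => hU' u x y
  let B' : X.V →ₗ[R] (psiMinus Y).V →ₗ[R] R := LinearMap.flip
    (((coinvKer Y fun _ => 1).liftQ B.flip hker : (psiMinus Y).V →ₗ[R] X.V →ₗ[R] R))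
  have hB' : B' = 0 := by
    refine eq_zero_of_invariantForms_psiMinus h B' (fun g x y => ?_) (fun u x y => ?_)
    · obtain ⟨y, rfl⟩ := Submodule.mkQ_surjective _ y
      exact hB g x y
    · obtain ⟨y, rfl⟩ := Submodule.mkQ_surjective _ y
      exact hU u x y
  ext x y
  exact LinearMap.congr_fun (LinearMap.congr_fun hB' x) ((coinvKer Y fun _ => 1).mkQ y)

variable [Fintype F] {ψ : AddChar F R}

/-- If a `GL`-invariant form vanishes on the eigenspace of one nontrivial character of the
unipotent radical, it vanishes on those of all nontrivial characters, as `GL` permutes them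
transitively; hence only the trivial character contributes. -/
theorem unipP_invariant_of_eq_zero (hψ : IsFourierChar ψ) {d : ℕ}
    {X : Rep.{v} R (mirabolic F (d + 1))} {Y : Type w} [AddCommGroup Y] [Module R Y]
    (σ : GLn (d + 1) F → Y →ₗ[R] Y)
    (B : X.V →ₗ[R] Y →ₗ[R] R)
    (hB : ∀ g x y, B (X.ρ (cornerP g) x) (σ g y) = B x y)
    (h : ∀ x, IsEigen ψ X (lastCovector F d) x → ∀ y, B x y = 0) (u : Fin (d + 1) → F)
    (x : X.V) (y : Y) : B (X.ρ (unipP u) x) y = B x y := by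
  have h1 : ∀ b ≠ 0, ∀ x y, B (avg ψ X b x) y = 0 := by
    intro b hb x y
    obtain ⟨g, hg⟩ := exists_vecMul_eq lastCovector_ne_zero hb
    rw [← hB g]
    exact h _ ((isEigen_avg b x).cornerP g hg) _
  have h2 : ∀ x y, B x y = B (avg ψ X 0 x) y := by
    intro x y
    conv_lhs => rw [← sum_avg hψ x]
    rw [map_sum, LinearMap.sum_apply, Finset.sum_eq_single 0]
    · exact fun b _ hb => h1 b hb x y
    · simp
  rw [h2, h2 x, ← sub_eq_zero, ← LinearMap.sub_apply, ← map_sub, ← map_sub,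
    avg_mem_coinvKer, map_zero, LinearMap.zero_apply]
  exact Submodule.subset_span ⟨u, x, by simp⟩

/-- The form on `Φ⁻ Z × Y` induced by the restriction of a form on `Z × Y` to the
`ψ`-eigenspace of the unipotent radical. -/
def phiForm (ψ : AddChar F R) {d : ℕ} {Z : Rep.{v} R (mirabolic F (d + 1))} {Y : Type w}
    [AddCommGroup Y] [Module R Y] (B : Z.V →ₗ[R] Y →ₗ[R] R) :
    (phiMinus ψ Z).V →ₗ[R] Y →ₗ[R] R :=
  (coinvKer Z fun y => ψ (y (Fin.last d))).liftQ (B ∘ₗ avg ψ Z (lastCovector F d)) (by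
    intro z hz
    simp_rw [← lastCovector_dotProduct] at hz
    rw [LinearMap.mem_ker, LinearMap.comp_apply, avg_mem_coinvKer hz, map_zero])

theorem phiForm_phiMk {d : ℕ} {Z : Rep.{v} R (mirabolic F (d + 1))} {Y : Type w}
    [AddCommGroup Y] [Module R Y] (B : Z.V →ₗ[R] Y →ₗ[R] R) (z : Z.V) (y : Y) :
    phiForm ψ B (phiMk ψ Z z) y = B (avg ψ Z (lastCovector F d) z) y := rfl

/-- For every `t ≥ 1` there are no nonzero `GL_t`-invariant forms on
`Ψ⁻ (Φ⁻)^k Z × Ψ⁻ (Φ⁻)^k Z'`, where `t + k = d`. -/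
def NoInvariantForms (ψ : AddChar F R) : (d : ℕ) → (Z : Rep.{v} R (mirabolic F d)) →
    (Z' : Rep.{w} R (mirabolic F d)) → Prop
  | 0, _, _ => True
  | d + 1, Z, Z' => invariantForms (psiMinus Z) (psiMinus Z') = ⊥ ∧
      NoInvariantForms ψ d (phiMinus ψ Z) (phiMinus ψ⁻¹ Z')

/-- The filtration of Bernstein and Zelevinsky, seen by forms: if the derivatives below the top
one carry no invariant forms, a `P_{d+1}`-invariant form is determined by its values on Whittaker
vectors. -/
theorem eq_zero_of_noInvariantForms (hψ : IsFourierChar ψ) {d : ℕ}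
    {Z : Rep.{v} R (mirabolic F d)} {Z' : Rep.{w} R (mirabolic F d)}
    (h : NoInvariantForms ψ d Z Z') (D : Z.V →ₗ[R] Z'.V →ₗ[R] R)
    (hD : ∀ p z z', D (Z.ρ p z) (Z'.ρ p z') = D z z')
    (hW : ∀ z z', IsWhittakerVector ψ Z z → IsWhittakerVector ψ⁻¹ Z' z' → D z z' = 0) :
    D = 0 := by
  induction d with
  | zero =>
    ext z z'
    exact hW z z' (isWhittakerVector_zero z) (isWhittakerVector_zero z')
  | succ d ih =>
    obtain ⟨h0, h1⟩ := h
    -- `D` vanishes on pairs of eigenvectors for the characters `ψ` and `ψ⁻¹`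
    have hE : ∀ z z', IsEigen ψ Z (lastCovector F d) z →
        IsEigen ψ⁻¹ Z' (lastCovector F d) z' → D z z' = 0 := by
      let D' : (phiMinus ψ Z).V →ₗ[R] (phiMinus ψ⁻¹ Z').V →ₗ[R] R :=
        (phiForm ψ⁻¹ (phiForm ψ D).flip).flip
      have hD'mk : ∀ z z', D' (phiMk ψ Z z) (phiMk ψ⁻¹ Z' z') =
          D (avg ψ Z (lastCovector F d) z) (avg ψ⁻¹ Z' (lastCovector F d) z') :=
        fun _ _ => rfl
      have hD' : D' = 0 := by
        refine ih h1 D' (fun p x x' => ?_) (fun x x' hx hx' => ?_)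
        · obtain ⟨z, rfl⟩ := phiMk_surjective ψ Z x
          obtain ⟨z', rfl⟩ := phiMk_surjective ψ⁻¹ Z' x'
          rw [← phiMk_cornerP, ← phiMk_cornerP, hD'mk, hD'mk, avg_cornerP hψ,
            avg_cornerP hψ.inv, hD]
        · obtain ⟨z, hz, rfl⟩ := exists_isEigen_phiMk_eq hψ x
          obtain ⟨z', hz', rfl⟩ := exists_isEigen_phiMk_eq hψ.inv x'
          rw [hD'mk, avg_of_isEigen hψ hz, avg_of_isEigen hψ.inv hz']
          exact hW _ _ ((isWhittakerVector_succ hψ).mpr ⟨hz, hx⟩)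
            ((isWhittakerVector_succ hψ.inv).mpr ⟨hz', hx'⟩)
      intro z z' hz hz'
      have := hD'mk z z'
      rw [avg_of_isEigen hψ hz, avg_of_isEigen hψ.inv hz', hD'] at this
      exact this.symm
    -- eigenvectors for characters that are not inverse to each other are orthogonal
    have hE' : ∀ z, IsEigen ψ Z (lastCovector F d) z → ∀ z', D z z' = 0 := by
      intro z hz z'
      rw [← sum_avg hψ.inv z', map_sum]
      refine Finset.sum_eq_zero fun c _ => ?_
      by_cases hc : c = lastCovector F d
      · rw [hc]
        exact hE _ _ hz (isEigen_avg _ _)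
      · have h2 : ∀ y, D z (avg ψ⁻¹ Z' c z') =
            ψ ((lastCovector F d - c) ⬝ᵥ y) * D z (avg ψ⁻¹ Z' c z') := by
          intro y
          conv_lhs => rw [← hD (unipP y), hz y, isEigen_avg c z' y]
          rw [map_smul, map_smul, LinearMap.smul_apply, smul_smul, smul_eq_mul,
            AddChar.inv_apply, sub_dotProduct, sub_eq_add_neg, AddChar.map_add_eq_mul,
            mul_comm (ψ _)]
        have h3 : (Fintype.card (Fin (d + 1) → F) : R) * D z (avg ψ⁻¹ Z' c z') = 0 := by
          rw [← nsmul_eq_mul, ← Finset.card_univ, ← Finset.sum_const,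
            Finset.sum_congr rfl fun y _ => h2 y, ← Finset.sum_mul,
            hψ.sum_dotProduct_eq_zero (sub_ne_zero.mpr (Ne.symm hc)), zero_mul]
        rw [← one_mul (D z _), ← hψ.card_inv_mul (d + 1), mul_assoc, h3, mul_zero]
    have hU : ∀ u z z', D (Z.ρ (unipP u) z) z' = D z z' :=
      unipP_invariant_of_eq_zero hψ (fun g => Z'.ρ (cornerP g)) D (fun g => hD (cornerP g)) hE'
    refine eq_zero_of_invariantForms_psiMinus_psiMinus h0 D (fun g => hD (cornerP g)) hU ?_
    intro u z z'
    rw [← hU u, hD]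

/-- The restriction of a representation of `GL_{n+1}` to the mirabolic subgroup. -/
abbrev resMirabolic {n : ℕ} (V : Rep.{v} R (GLn (n + 1) F)) : Rep.{v} R (mirabolic F n) :=
  Rep.of (V.ρ.comp (mirabolic F n).subtype)

theorem eq_zero_of_noInvariantForms_of_GLn (hψ : IsFourierChar ψ) {d : ℕ}
    {X : Rep.{v} R (mirabolic F (d + 1))} {Y : Rep.{w} R (GLn (d + 1) F)}
    (h0 : invariantForms (psiMinus X) Y = ⊥)
    (h1 : NoInvariantForms ψ d (phiMinus ψ X) (resMirabolic Y))
    (B : X.V →ₗ[R] Y.V →ₗ[R] R)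
    (hB : ∀ g x y, B (X.ρ (cornerP g) x) (Y.ρ g y) = B x y)
    (hW : ∀ x y, IsWhittakerVector ψ X x → IsWhittakerVector ψ⁻¹ (resMirabolic Y) y → B x y = 0) :
    B = 0 := by
  refine eq_zero_of_invariantForms_psiMinus h0 B hB ?_
  refine unipP_invariant_of_eq_zero hψ (fun g => Y.ρ g) B hB ?_
  have hB' : (phiForm ψ B : (phiMinus ψ X).V →ₗ[R] (resMirabolic Y).V →ₗ[R] R) = 0 := by
    refine eq_zero_of_noInvariantForms hψ h1 _ (fun p x y => ?_) (fun x y hx hy => ?_)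
    · obtain ⟨z, rfl⟩ := phiMk_surjective ψ X x
      rw [← phiMk_cornerP, phiForm_phiMk, phiForm_phiMk, avg_cornerP hψ]
      exact hB _ _ _
    · obtain ⟨z, hz, rfl⟩ := exists_isEigen_phiMk_eq hψ x
      rw [phiForm_phiMk, avg_of_isEigen hψ hz]
      exact hW _ _ ((isWhittakerVector_succ hψ).mpr ⟨hz, hx⟩) hy
  intro x hx y
  have := phiForm_phiMk (ψ := ψ) B x y
  rw [avg_of_isEigen hψ hx] at this
  rw [← this, hB']
  rfl

theorem corner_mem_mirabolic_of_add {m r : ℕ} (g : GLn m F) :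
    corner (rfl : m + (r + 1) = m + r + 1) g ∈ mirabolic F (m + r) := by
  have h := corner_corner (rfl : m + r = m + r) (rfl : m + r + 1 = m + r + 1)
    (rfl : m + (r + 1) = m + r + 1) g
  exact h ▸ corner_mem_mirabolic (corner (rfl : m + r = m + r) g)

/-- A form on `V × Y` that is invariant under `GL_m` and `(U_{m+r+1,r}, ψ)`-equivariant in the
first variable descends to `(Φ⁻)^r V`. -/
theorem exists_form_phiMinusIter {m : ℕ} (r : ℕ) {V : Rep.{v} R (mirabolic F (m + r))}
    {Y : Rep.{w} R (GLn m F)} (C : V.V →ₗ[R] Y.V →ₗ[R] R)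
    (hC : ∀ (g : GLn m F) x y,
      C (V.ρ ⟨corner (rfl : m + (r + 1) = m + r + 1) g, corner_mem_mirabolic_of_add g⟩ x)
        (Y.ρ g y) = C x y)
    (hU : ∀ u : GLn (m + r + 1) F, ∀ hu : u ∈ unipSubgroup F (m + r + 1) r, ∀ x y,
      C (V.ρ ⟨u, maxUnip_le_mirabolic _ (unipSubgroup_le_maxUnip _ _ hu)⟩ x) y =
        ψ (superdiagSum u) * C x y) :
    ∃ B : (phiMinusIter ψ r V).V →ₗ[R] Y.V →ₗ[R] R,
      (∀ g x y, B ((phiMinusIter ψ r V).ρ (cornerP g) x) (Y.ρ g y) = B x y) ∧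
      ∀ x y, B (phiMinusIterMk ψ r V x) y = C x y := by
  induction r with
  | zero => exact ⟨C, hC, fun _ _ => rfl⟩
  | succ r ih =>
    let Z : Rep.{v} R (mirabolic F (m + r + 1)) := V
    have hker : coinvKer Z (fun y => ψ (y (Fin.last (m + r)))) ≤ LinearMap.ker C := by
      refine Submodule.span_le.mpr ?_
      rintro _ ⟨u, x, rfl⟩
      rw [SetLike.mem_coe, LinearMap.mem_ker, map_sub, map_smul, sub_eq_zero]
      ext y
      have := hU (unip u) (unip_mem_unipSubgroup r u) x y
      rw [superdiagSum_unip] at this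
      exact this
    let C' : (phiMinus ψ Z).V →ₗ[R] Y.V →ₗ[R] R := Submodule.liftQ _ C hker
    have hC' : ∀ x y, C' (phiMk ψ Z x) y = C x y := fun _ _ => rfl
    have h1 : ∀ (g : GLn m F) x y, C' ((phiMinus ψ Z).ρ
        ⟨corner (rfl : m + (r + 1) = m + r + 1) g, corner_mem_mirabolic_of_add g⟩ x)
        (Y.ρ g y) = C' x y := by
      intro g x y
      obtain ⟨x, rfl⟩ := phiMk_surjective ψ Z x
      have h2 : cornerP (corner (rfl : m + (r + 1) = m + r + 1) g) =
          (⟨corner (rfl : m + (r + 1 + 1) = m + (r + 1) + 1) g, corner_mem_mirabolic_of_add g⟩ :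
            mirabolic F (m + r + 1)) :=
        Subtype.ext (corner_corner (rfl : m + (r + 1) = m + r + 1) rfl rfl g)
      rw [← phiMk_cornerP, hC', hC', h2]
      exact hC g x y
    have h3 : ∀ u : GLn (m + r + 1) F, ∀ hu : u ∈ unipSubgroup F (m + r + 1) r, ∀ x y,
        C' ((phiMinus ψ Z).ρ
          ⟨u, maxUnip_le_mirabolic _ (unipSubgroup_le_maxUnip _ _ hu)⟩ x) y =
        ψ (superdiagSum u) * C' x y := by
      intro u hu x y
      obtain ⟨x, rfl⟩ := phiMk_surjective ψ Z x
      rw [← phiMk_cornerP, hC', hC']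
      have := hU (corner rfl u) (corner_mem_unipSubgroup hu) x y
      rw [superdiagSum_corner] at this
      exact this
    obtain ⟨B, hB, hBC⟩ := ih (V := phiMinus ψ Z) C' h1 h3
    exact ⟨B, hB, fun x y => (hBC _ _).trans (hC' x y)⟩

end Vanishing

/-! ### Non-exceptional pairs -/

section NonExceptional

variable {F : Type*} [Field F] {R : Type u} [CommRing R]

set_option linter.unusedSectionVars false

/-- For every `t ≥ 1` there are no nonzero `GL_t`-invariant forms on
`Ψ⁻ (Φ⁻)^k Z × Ψ⁻ (Φ⁻)^l Z'`, where `t + k = D` and `t + l = d`. The heterogeneous equalities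
express that `Z₀` is `Z`, viewed as a representation of `P_{t+k+1}`. -/
def NoDerivativeForms (ψ : AddChar F R) {D d : ℕ} (Z : Rep.{v} R (mirabolic F D))
    (Z' : Rep.{w} R (mirabolic F d)) : Prop :=
  ∀ (t k l : ℕ) (Z₀ : Rep.{v} R (mirabolic F (t + k))) (Z₀' : Rep.{w} R (mirabolic F (t + l))),
    1 ≤ t → t + k = D → t + l = d → HEq Z₀ Z → HEq Z₀' Z' →
    invariantForms (psiMinus (phiMinusIter ψ k Z₀)) (psiMinus (phiMinusIter ψ⁻¹ l Z₀')) = ⊥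

variable {ψ : AddChar F R}

theorem NoDerivativeForms.phiMinus_left {D d : ℕ} {Z : Rep.{v} R (mirabolic F (D + 1))}
    {Z' : Rep.{w} R (mirabolic F d)} (h : NoDerivativeForms ψ Z Z') :
    NoDerivativeForms ψ (phiMinus ψ Z) Z' := by
  rintro t k l Z₀ Z₀' ht rfl rfl h1 h2
  obtain rfl := eq_of_heq h1
  exact h t (k + 1) l Z Z₀' ht rfl rfl HEq.rfl h2

theorem NoDerivativeForms.phiMinus_right {D d : ℕ} {Z : Rep.{v} R (mirabolic F D)}
    {Z' : Rep.{w} R (mirabolic F (d + 1))} (h : NoDerivativeForms ψ Z Z') :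
    NoDerivativeForms ψ Z (phiMinus ψ⁻¹ Z') := by
  rintro t k l Z₀ Z₀' ht rfl rfl h1 h2
  obtain rfl := eq_of_heq h2
  exact h t k (l + 1) Z₀ Z' ht rfl rfl h1 HEq.rfl

theorem NoDerivativeForms.phiMinusIter_left {D d r : ℕ} {Z : Rep.{v} R (mirabolic F (D + r))}
    {Z' : Rep.{w} R (mirabolic F d)} (h : NoDerivativeForms ψ Z Z') :
    NoDerivativeForms ψ (phiMinusIter ψ r Z) Z' := by
  induction r with
  | zero => exact h
  | succ r ih => exact ih (h.phiMinus_left (D := D + r))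

theorem NoDerivativeForms.noInvariantForms {d : ℕ} {Z : Rep.{v} R (mirabolic F d)}
    {Z' : Rep.{w} R (mirabolic F d)} (h : NoDerivativeForms ψ Z Z') :
    NoInvariantForms ψ d Z Z' := by
  induction d with
  | zero => trivial
  | succ d ih =>
    exact ⟨h (d + 1) 0 0 Z Z' (by omega) rfl rfl HEq.rfl HEq.rfl,
      ih h.phiMinus_left.phiMinus_right⟩

theorem castGL_rfl {a : ℕ} : castGL (F := F) (rfl : a = a) = MonoidHom.id _ := by
  ext g i j
  rfl

theorem derivative_rfl {t k : ℕ} (V : Rep.{v} R (GLn (t + k) F)) :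
    derivative ψ rfl V = derivativeAux ψ k V := by
  rw [derivative, castGL_rfl]
  rfl

theorem invariantForms_eq_bot_congr {G : Type*} [Group G] {V V₁ : Rep.{v} R G}
    {W W₁ : Rep.{w} R G} (hV : V = V₁) (hW : W = W₁) :
    invariantForms V W = ⊥ ↔ invariantForms V₁ W₁ = ⊥ := by
  subst hV hW
  rfl

theorem noDerivativeForms_of_not_isExceptional {N M : ℕ} {V : Rep.{v} R (GLn (N + 1) F)}
    {V' : Rep.{w} R (GLn (M + 1) F)} (hex : ¬ IsExceptional ψ V V') :
    NoDerivativeForms ψ (resMirabolic (whittakerRep ψ V))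
      (resMirabolic (whittakerRep ψ⁻¹ V')) := by
  rintro t k l Z₀ Z₀' ht rfl rfl h1 h2
  obtain rfl := eq_of_heq h1
  obtain rfl := eq_of_heq h2
  by_contra h
  refine hex ⟨t, k + 1, l + 1, rfl, rfl, ht, ?_⟩
  rw [Ne, invariantForms_eq_bot_congr (derivative_rfl (k := k + 1) _)
    (derivative_rfl (k := l + 1) _)]
  exact h

theorem invariantForms_eq_bot_of_not_isExceptional {d r : ℕ}
    {V : Rep.{v} R (GLn (d + 1 + (r + 1)) F)}
    {V' : Rep.{w} R (GLn (d + 1) F)} (hex : ¬ IsExceptional ψ V V') :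
    invariantForms (psiMinus (phiMinusIter ψ r
      (resMirabolic (n := d + 1 + r) (whittakerRep ψ V)))) (whittakerRep ψ⁻¹ V') = ⊥ := by
  by_contra h
  refine hex ⟨d + 1, r + 1, 0, rfl, rfl, by omega, ?_⟩
  rw [Ne, invariantForms_eq_bot_congr (derivative_rfl (k := r + 1) _)
    (derivative_rfl (k := 0) _)]
  exact h

/-- For a non-exceptional pair, an equivariant form is determined by its values on Whittaker
vectors. -/
theorem eq_zero_of_mem_equivariantForms [Fintype F] (hψ : IsFourierChar ψ) {d r : ℕ}
    {V : Rep.{v} R (GLn (d + 1 + (r + 1)) F)}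
    {V' : Rep.{w} R (GLn (d + 1) F)} (hex : ¬ IsExceptional ψ V V')
    {C : (whittakerRep ψ V).V →ₗ[R] (whittakerRep ψ⁻¹ V').V →ₗ[R] R}
    (hC : C ∈ equivariantForms ψ (rfl : d + 1 + (r + 1) = d + 1 + (r + 1)) V V')
    (hW : ∀ x y, IsWhittakerVector ψ (resMirabolic (n := d + 1 + r) (whittakerRep ψ V)) x →
      IsWhittakerVector ψ⁻¹ (resMirabolic (whittakerRep ψ⁻¹ V')) y → C x y = 0) : C = 0 := by
  obtain ⟨B, hB, hBC⟩ := exists_form_phiMinusIter (ψ := ψ) (m := d + 1) r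
    (V := resMirabolic (n := d + 1 + r) (whittakerRep ψ V)) (Y := whittakerRep ψ⁻¹ V') C
    (fun g x y => by
      have := hC g 1 (one_mem _) x y
      rw [mul_one, superdiagSum_one, AddChar.map_zero_eq_one, one_mul] at this
      exact this)
    (fun u hu x y => by
      have := hC 1 u hu x y
      rw [map_one, map_one, one_mul] at this
      exact this)
  have hB0 : B = 0 := by
    refine eq_zero_of_noInvariantForms_of_GLn hψ
      (invariantForms_eq_bot_of_not_isExceptional hex)
      (NoDerivativeForms.noInvariantForms ?_) B hB ?_
    · exact ((noDerivativeForms_of_not_isExceptional (N := d + 1 + r)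
        hex).phiMinusIter_left (D := d + 1)).phiMinus_left
    · intro x y hx hy
      obtain ⟨z, hz, rfl⟩ := exists_isWhittakerVector_phiMinusIterMk_eq hψ r _ x hx
      rw [hBC]
      exact hW z y hz hy
  ext x y
  rw [← hBC, hB0]
  rfl

end NonExceptional

/-! ### Functions with two-sided equivariance under the maximal unipotent subgroup -/

section Support

variable {F : Type*} [Field F] [Fintype F] {R : Type u} [CommRing R]

set_option linter.unusedSectionVars false

variable (R F) in
/-- The functions `f` on `GL_n` with `f(u g) = ψ(u) f(g)` for `u ∈ N_n`. -/
def whittakerFunctions (ψ : AddChar F R) (n : ℕ) : Submodule R (GLn n F → R) where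
  carrier := {f | ∀ u ∈ maxUnip F n, ∀ g, f (u * g) = ψ (superdiagSum u) * f g}
  zero_mem' := fun _ _ _ => by simp
  add_mem' := fun {f f'} hf hf' u hu g => by
    rw [Pi.add_apply, Pi.add_apply, hf u hu, hf' u hu, mul_add]
  smul_mem' := fun c f hf u hu g => by
    rw [Pi.smul_apply, Pi.smul_apply, hf u hu, smul_eq_mul, smul_eq_mul, mul_left_comm]

/-- A Bessel function: `f(u g) = f(g u) = ψ(u) f(g)` for `u ∈ N_n`. -/
structure IsBessel (ψ : AddChar F R) {n : ℕ} (f : GLn n F → R) : Prop where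
  left : ∀ u ∈ maxUnip F n, ∀ g, f (u * g) = ψ (superdiagSum u) * f g
  right : ∀ u ∈ maxUnip F n, ∀ g, f (g * u) = ψ (superdiagSum u) * f g

variable {ψ : AddChar F R}

/-- The sum over `i`, `j` with `i + 1 = a + j` is the single entry of `z` just above the diagonal
of `(u z; 0 v)`. -/
theorem crossSum_eq {a r : ℕ} (z : Matrix (Fin (a + 1)) (Fin (r + 1)) F) :
    (∑ i : Fin (a + 1), ∑ j : Fin (r + 1), if (i : ℕ) + 1 = a + 1 + j then z i j else 0)
      = z (Fin.last a) 0 := by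
  rw [Finset.sum_eq_single (Fin.last a), Finset.sum_eq_single 0]
  · simp
  · intro j _ hj
    have : (j : ℕ) ≠ 0 := fun h => hj (Fin.ext h)
    simp [this]
  · simp
  · intro i _ hi
    have : (i : ℕ) ≠ a := fun h => hi (Fin.ext h)
    refine Finset.sum_eq_zero fun j _ => if_neg ?_
    omega
  · simp

theorem IsBessel.corner_eq_zero (hψ : IsFourierChar ψ) {a r n : ℕ} (h : a + (r + 1) = n)
    {f : GLn n F → R} (hf : IsBessel ψ f) {x : GLn a F} (hx : x ∉ maxUnip F a) :
    f (corner h x) = 0 := by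
  induction a generalizing r with
  | zero => exact absurd (fun i => i.elim0) hx
  | succ a ih =>
    by_cases hrow : x ∈ mirabolic F a
    · obtain ⟨y, x', rfl⟩ := exists_eq_unip_mul_corner hrow
      rw [Subgroup.mul_mem_cancel_left _ (unip_mem_maxUnip y), corner_mem_maxUnip] at hx
      rw [map_mul, hf.left _ ((corner_mem_maxUnip _).mpr (unip_mem_maxUnip y)),
        corner_corner rfl h (by omega : a + (r + 1 + 1) = n), ih _ hx, mul_zero]
    · -- conjugation by `x` moves the character of the unipotent radical, as the last row of `x`
      -- is not `(0, …, 0, 1)`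
      have hb : Matrix.vecMul (lastCovector F a) x.1 - lastCovector F a ≠ 0 := by
        rw [sub_ne_zero, lastCovector, Matrix.single_one_vecMul]
        exact hrow
      let z : (Fin (a + 1) → F) → Matrix (Fin (a + 1)) (Fin (r + 1)) F :=
        fun y i j => if j = 0 then y i else 0
      have hmul : ∀ y, x.1 * z y = z (Matrix.mulVec x.1 y) := by
        intro y
        ext i j
        rw [Matrix.mul_apply]
        simp only [z]
        split_ifs <;> simp [Matrix.mulVec, dotProduct]
      have hz : ∀ y, upperBlock h 1 (z y) 1 ∈ maxUnip F n := fun y =>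
        (upperBlock_mem_maxUnip h).mpr ⟨one_mem _, one_mem _⟩
      have hsz : ∀ y, superdiagSum (upperBlock h 1 (z y) 1) = lastCovector F a ⬝ᵥ y := by
        intro y
        rw [superdiagSum_upperBlock, superdiagSum_one, superdiagSum_one, crossSum_eq,
          lastCovector_dotProduct]
        simp [z]
      have hcomm : ∀ y, corner h x * upperBlock h 1 (z y) 1 =
          upperBlock h 1 (z (Matrix.mulVec x.1 y)) 1 * corner h x := by
        intro y
        rw [corner_eq_upperBlock, upperBlock_mul, upperBlock_mul, hmul]
        simp
      have h1 : ∀ y, ψ ((Matrix.vecMul (lastCovector F a) x.1 - lastCovector F a) ⬝ᵥ y) *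
          f (corner h x) = f (corner h x) := by
        intro y
        have h2 := hf.right _ (hz y) (corner h x)
        rw [hcomm, hf.left _ (hz _), hsz, hsz, Matrix.dotProduct_mulVec] at h2
        rw [sub_dotProduct, sub_eq_add_neg, AddChar.map_add_eq_mul, mul_right_comm, h2,
          mul_right_comm, ← AddChar.map_add_eq_mul, add_neg_cancel, AddChar.map_zero_eq_one,
          one_mul]
      have h3 : (Fintype.card (Fin (a + 1) → F) : R) * f (corner h x) = 0 := by
        rw [← nsmul_eq_mul, ← Finset.card_univ, ← Finset.sum_const,
          ← Finset.sum_congr rfl fun y _ => h1 y, ← Finset.sum_mul,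
          hψ.sum_dotProduct_eq_zero hb, zero_mul]
      rw [← one_mul (f _), ← hψ.card_inv_mul (a + 1), mul_assoc, h3, mul_zero]

/-- A Bessel function vanishes on the mirabolic subgroup outside `N_{n+1}`. -/
theorem IsBessel.eq_zero_of_mem_mirabolic (hψ : IsFourierChar ψ) {n : ℕ}
    {f : GLn (n + 1) F → R} (hf : IsBessel ψ f) {p : GLn (n + 1) F} (hp : p ∈ mirabolic F n)
    (hp' : p ∉ maxUnip F (n + 1)) : f p = 0 := by
  obtain ⟨y, g, rfl⟩ := exists_eq_unip_mul_corner hp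
  rw [Subgroup.mul_mem_cancel_left _ (unip_mem_maxUnip y), corner_mem_maxUnip] at hp'
  rw [hf.left _ (unip_mem_maxUnip y), hf.corner_eq_zero hψ (r := 0) rfl hp', mul_zero]

/-- The transpose about the antidiagonal, an anti-involution of `GL_n` that preserves `N_n` and
its generic characters. -/
def antiTranspose {n : ℕ} (g : GLn n F) : GLn n F where
  val := (g.1.submatrix Fin.revPerm Fin.revPerm).transpose
  inv := ((g⁻¹).1.submatrix Fin.revPerm Fin.revPerm).transpose
  val_inv := by
    rw [← Matrix.transpose_mul, Matrix.submatrix_mul_equiv, ← Units.val_mul, inv_mul_cancel]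
    simp
  inv_val := by
    rw [← Matrix.transpose_mul, Matrix.submatrix_mul_equiv, ← Units.val_mul, mul_inv_cancel]
    simp

theorem antiTranspose_apply {n : ℕ} (g : GLn n F) (i j : Fin n) :
    (antiTranspose g).1 i j = g.1 j.rev i.rev := rfl

theorem antiTranspose_mul {n : ℕ} (g h : GLn n F) :
    antiTranspose (g * h) = antiTranspose h * antiTranspose g := by
  apply Units.ext
  change ((g * h).1.submatrix Fin.revPerm Fin.revPerm).transpose =
    (h.1.submatrix Fin.revPerm Fin.revPerm).transpose *
      (g.1.submatrix Fin.revPerm Fin.revPerm).transpose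
  rw [← Matrix.transpose_mul, Matrix.submatrix_mul_equiv, Units.val_mul]

theorem antiTranspose_antiTranspose {n : ℕ} (g : GLn n F) :
    antiTranspose (antiTranspose g) = g := by
  apply Units.ext
  ext i j
  simp [antiTranspose_apply]

theorem antiTranspose_mem_maxUnip {n : ℕ} {g : GLn n F} (hg : g ∈ maxUnip F n) :
    antiTranspose g ∈ maxUnip F n := by
  intro i j hij
  rw [antiTranspose_apply, hg _ _ (by rw [Fin.rev_le_rev]; omega)]
  simp [Matrix.one_apply, eq_comm]

theorem superdiagSum_antiTranspose {n : ℕ} (g : GLn n F) :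
    superdiagSum (antiTranspose g) = superdiagSum g := by
  unfold superdiagSum
  rw [Finset.sum_comm, ← Equiv.sum_comp Fin.revPerm]
  refine Finset.sum_congr rfl fun i _ => ?_
  rw [← Equiv.sum_comp Fin.revPerm]
  refine Finset.sum_congr rfl fun j _ => ?_
  rw [antiTranspose_apply]
  simp only [Fin.revPerm_apply, Fin.rev_rev, Fin.val_rev]
  exact if_congr (by omega) rfl rfl

theorem IsBessel.antiTranspose {n : ℕ} {f : GLn n F → R} (hf : IsBessel ψ f) :
    IsBessel ψ fun g => f (FiniteGL.antiTranspose g) where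
  left u hu g := by
    rw [antiTranspose_mul, hf.right _ (antiTranspose_mem_maxUnip hu), superdiagSum_antiTranspose]
  right u hu g := by
    rw [antiTranspose_mul, hf.left _ (antiTranspose_mem_maxUnip hu), superdiagSum_antiTranspose]

/-- A Bessel function vanishes outside `N_{n+1}` on the matrices with first column
`(1, 0, …, 0)`. -/
theorem IsBessel.eq_zero_of_first_col (hψ : IsFourierChar ψ) {n : ℕ}
    {f : GLn (n + 1) F → R} (hf : IsBessel ψ f) {p : GLn (n + 1) F}
    (hp : ∀ i, p.1 i 0 = (1 : Matrix (Fin (n + 1)) (Fin (n + 1)) F) i 0)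
    (hp' : p ∉ maxUnip F (n + 1)) : f p = 0 := by
  rw [← antiTranspose_antiTranspose p]
  refine hf.antiTranspose.eq_zero_of_mem_mirabolic hψ ?_ ?_
  · change (FiniteGL.antiTranspose p).1 (Fin.last n) = _
    ext j
    rw [antiTranspose_apply, Fin.rev_last, hp, Matrix.one_apply, Pi.single_apply]
    exact if_congr (by rw [Fin.rev_eq_iff, Fin.rev_zero]) rfl rfl
  · intro h
    apply hp'
    rw [← antiTranspose_antiTranspose p]
    exact antiTranspose_mem_maxUnip h

end Support

/-! ### Whittaker functionals and the Bessel function of a Whittaker model -/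

section Functional

variable {F : Type*} [Field F] [Fintype F] {R : Type u} [CommRing R]

set_option linter.unusedSectionVars false

/-- A linear form on `V` that identifies `V / V(N_{n+1}, ψ)` with `R`. -/
structure IsWhittakerFunctional (ψ : AddChar F R) {n : ℕ} (V : Rep.{v} R (GLn (n + 1) F))
    (l : V.V →ₗ[R] R) : Prop where
  surjective : Function.Surjective l
  ker_eq : LinearMap.ker l = whittakerKer ψ (resMirabolic V)

variable {ψ : AddChar F R} {n : ℕ} {V : Rep.{v} R (GLn (n + 1) F)}

theorem whittakerKer_castGL {a : ℕ} (h : a = n) (h' : a + 1 = n + 1) :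
    whittakerKer ψ (resMirabolic (n := a) (Rep.of (V.ρ.comp (castGL h')))) =
      whittakerKer ψ (resMirabolic V) := by
  subst h
  rw [castGL_rfl]
  rfl

theorem coinvKer_zero_eq_bot (Z : Rep.{v} R (mirabolic F 0)) : coinvKer Z (fun _ => 1) = ⊥ := by
  rw [coinvKer, Submodule.span_eq_bot]
  rintro _ ⟨y, x, rfl⟩
  rw [Subsingleton.elim y 0, unipP_zero]
  simp

theorem ker_derivativeMk : LinearMap.ker (derivativeMk ψ (Nat.zero_add (n + 1)) V) =
    whittakerKer ψ (resMirabolic V) := by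
  rw [← whittakerKer_castGL (Nat.zero_add n) (Nat.zero_add (n + 1))]
  refine Eq.trans ?_ (ker_phiMinusIterMk n (resMirabolic (n := 0 + n)
    (Rep.of (V.ρ.comp (castGL (Nat.zero_add (n + 1)))))))
  ext x
  refine (Submodule.Quotient.mk_eq_zero _).trans ?_
  rw [coinvKer_zero_eq_bot]
  rfl

theorem derivativeMk_surjective :
    Function.Surjective (derivativeMk ψ (Nat.zero_add (n + 1)) V) :=
  (Submodule.mkQ_surjective _).comp (phiMinusIterMk_surjective n _)

theorem isWhittakerFunctional_of_equiv (e : (topDerivative ψ V).V ≃ₗ[R] R) :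
    IsWhittakerFunctional ψ V
      (e.toLinearMap ∘ₗ derivativeMk ψ (Nat.zero_add (n + 1)) V) where
  surjective := e.surjective.comp derivativeMk_surjective
  ker_eq := by rw [LinearEquiv.ker_comp, ker_derivativeMk]

theorem IsWhittakerType.exists_isWhittakerFunctional (h : IsWhittakerType ψ V) :
    ∃ l, IsWhittakerFunctional ψ V l :=
  let ⟨e⟩ := h
  ⟨_, isWhittakerFunctional_of_equiv e⟩

variable {l : V.V →ₗ[R] R}

/-- A Whittaker functional factors through an isomorphism of the top derivative with `R`. -/
theorem IsWhittakerFunctional.exists_equiv (hl : IsWhittakerFunctional ψ V l) :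
    ∃ e : (topDerivative ψ V).V ≃ₗ[R] R,
      e.toLinearMap ∘ₗ derivativeMk ψ (Nat.zero_add (n + 1)) V = l := by
  let q := derivativeMk ψ (Nat.zero_add (n + 1)) V
  have hker : LinearMap.ker q = LinearMap.ker l := by rw [hl.ker_eq]; exact ker_derivativeMk
  let e₁ := q.quotKerEquivOfSurjective derivativeMk_surjective
  let e₂ := l.quotKerEquivOfSurjective hl.surjective
  refine ⟨e₁.symm ≪≫ₗ Submodule.quotEquivOfEq _ _ hker ≪≫ₗ e₂, ?_⟩
  ext x
  have : e₁.symm (q x) = Submodule.Quotient.mk x := by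
    rw [LinearEquiv.symm_apply_eq]; rfl
  change e₂ (Submodule.quotEquivOfEq _ _ hker (e₁.symm (q x))) = l x
  rw [this]
  rfl

theorem IsWhittakerFunctional.isWhittakerType (hl : IsWhittakerFunctional ψ V l) :
    IsWhittakerType ψ V :=
  let ⟨e, _⟩ := hl.exists_equiv
  ⟨e⟩

/-- The map from `V` to functions on the group, `v ↦ (g ↦ l(g v))`. -/
def matrixCoeff (l : V.V →ₗ[R] R) : V.V →ₗ[R] (GLn (n + 1) F → R) :=
  LinearMap.pi fun g => l ∘ₗ V.ρ g

theorem matrixCoeff_apply (v : V.V) (g : GLn (n + 1) F) : matrixCoeff l v g = l (V.ρ g v) := rfl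

theorem IsWhittakerFunctional.whittakerModel_eq (hl : IsWhittakerFunctional ψ V l) :
    whittakerModel ψ V = LinearMap.range (matrixCoeff l) := by
  obtain ⟨e, he⟩ := hl.exists_equiv
  rw [whittakerModel_eq_range ψ V e.toLinearMap]
  · congr 1
    subst he
    rfl
  · refine eq_top_iff.mpr fun f _ => Submodule.mem_span_singleton.mpr ⟨f (e.symm 1), ?_⟩
    ext x
    rw [LinearMap.smul_apply, smul_eq_mul, mul_comm, ← smul_eq_mul, ← map_smul]
    congr 1
    rw [LinearEquiv.coe_coe, ← map_smul, LinearEquiv.symm_apply_eq, smul_eq_mul, mul_one]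

theorem IsWhittakerFunctional.apply_maxUnip (hl : IsWhittakerFunctional ψ V l)
    {u : GLn (n + 1) F} (hu : u ∈ maxUnip F (n + 1)) (v : V.V) :
    l (V.ρ u v) = ψ (superdiagSum u) * l v := by
  rw [← smul_eq_mul, ← map_smul, ← sub_eq_zero, ← map_sub, ← LinearMap.mem_ker, hl.ker_eq]
  exact Submodule.subset_span ⟨⟨u, hu⟩, v, rfl⟩

theorem whittakerModel_le_whittakerFunctions (hV : IsWhittakerType ψ V) :
    whittakerModel ψ V ≤ whittakerFunctions F R ψ (n + 1) := by
  obtain ⟨l, hl⟩ := hV.exists_isWhittakerFunctional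
  rw [hl.whittakerModel_eq]
  rintro _ ⟨v, rfl⟩ u hu g
  rw [matrixCoeff_apply, map_mul, Module.End.mul_apply, hl.apply_maxUnip hu]
  rfl

/-- The Whittaker vectors in the Whittaker model are the multiples of a Bessel function with
value `1` at the identity. -/
theorem exists_bessel (hψ : IsFourierChar ψ) (hV : IsWhittakerType ψ V) :
    ∃ W₀ : (whittakerRep ψ V).V, W₀.1 1 = 1 ∧ IsBessel ψ W₀.1 ∧
      ∀ W, IsWhittakerVector ψ (resMirabolic (whittakerRep ψ V)) W → ∃ c : R, W = c • W₀ := by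
  obtain ⟨l, hl⟩ := hV.exists_isWhittakerFunctional
  obtain ⟨v, hv⟩ := hl.surjective 1
  obtain ⟨v₀, hv₀, hvv₀⟩ := exists_isWhittakerVector hψ (Z := resMirabolic V) v
  have hlv₀ : l v₀ = 1 := by
    rw [← hv, eq_comm, ← sub_eq_zero, ← map_sub, ← LinearMap.mem_ker, hl.ker_eq]
    exact hvv₀
  have hmem : ∀ x, matrixCoeff l x ∈ whittakerModel ψ V := fun x => by
    rw [hl.whittakerModel_eq]; exact ⟨x, rfl⟩
  let T : V.V →ₗ[R] (whittakerRep ψ V).V := (matrixCoeff l).codRestrict _ hmem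
  have hT : ∀ g x, T (V.ρ g x) = (whittakerRep ψ V).ρ g (T x) := by
    intro g x
    apply Subtype.ext
    funext a
    change l (V.ρ a (V.ρ g x)) = l (V.ρ (a * g) x)
    rw [map_mul]
    rfl
  have hTv₀ : IsWhittakerVector ψ (resMirabolic (whittakerRep ψ V)) (T v₀) := by
    intro u
    rw [← map_smul, ← hv₀ u]
    exact (hT _ _).symm
  refine ⟨T v₀, ?_, ⟨?_, ?_⟩, ?_⟩
  · change l (V.ρ 1 v₀) = 1
    rw [map_one]
    exact hlv₀
  · exact whittakerModel_le_whittakerFunctions hV (T v₀).2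
  · intro u hu g
    exact congrFun (congrArg Subtype.val (hTv₀ ⟨u, hu⟩)) g
  · intro W hW
    obtain ⟨x, hx⟩ : ∃ x, T x = W := by
      obtain ⟨x, hx⟩ := (hl.whittakerModel_eq ▸ W.2 : W.1 ∈ LinearMap.range (matrixCoeff l))
      exact ⟨x, Subtype.ext hx⟩
    refine ⟨l x, ?_⟩
    rw [← sub_eq_zero]
    refine (hW.sub (hTv₀.smul (l x))).eq_zero hψ ?_
    rw [← hx, ← map_smul, ← map_sub]
    have hxk : x - l x • v₀ ∈ whittakerKer ψ (resMirabolic V) := by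
      rw [← hl.ker_eq, LinearMap.mem_ker, map_sub, map_smul, hlv₀, smul_eq_mul, mul_one, sub_self]
    have hle : whittakerKer ψ (resMirabolic V) ≤
        (whittakerKer ψ (resMirabolic (whittakerRep ψ V))).comap T := by
      refine Submodule.span_le.mpr ?_
      rintro _ ⟨u, y, rfl⟩
      refine Submodule.subset_span ⟨u, T y, ?_⟩
      rw [map_sub, map_smul]
      congr 1
      exact hT _ _
    exact hle hxk

end Functional

/-! ### Sums over `N_m \ G_m` -/

section CosetSum

variable {F : Type*} [Field F] [Fintype F]

set_option linter.unusedSectionVars false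

theorem cosetSum_mul_right {S : Type*} [AddCommMonoid S] {m : ℕ} {f : GLn m F → S}
    (hf : ∀ u ∈ maxUnip F m, ∀ x, f (u * x) = f x) (g : GLn m F) :
    cosetSum (fun x => f (x * g)) = cosetSum f := by
  let Q := Quotient (QuotientGroup.rightRel (maxUnip F m))
  have hwd : ∀ (g : GLn m F) (a b : GLn m F), (QuotientGroup.rightRel (maxUnip F m)) a b →
      (QuotientGroup.rightRel (maxUnip F m)) (a * g) (b * g) := by
    intro g a b hab
    rw [QuotientGroup.rightRel_apply] at hab ⊢
    simpa [mul_assoc] using hab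
  let σ : GLn m F → Q → Q := fun g => Quotient.map (· * g) fun a b => hwd g a b
  have hσ : ∀ g x, σ g (σ g⁻¹ x) = x := by
    intro g x
    induction x using Quotient.inductionOn with
    | h x => exact congrArg (Quotient.mk _) (by simp)
  let e : Q ≃ Q := ⟨σ g, σ g⁻¹, fun x => by simpa using hσ g⁻¹ x, hσ g⟩
  let s : Q → GLn m F := fun x => (σ g⁻¹ x).out * g
  have hs : ∀ x, Quotient.mk _ (s x) = x := by
    intro x
    refine Eq.trans ?_ (hσ g x)
    conv_rhs => rw [← Quotient.out_eq (σ g⁻¹ x)]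
    rfl
  rw [cosetSum_eq f hf s hs, ← finsum_comp_equiv e]
  refine finsum_congr fun x => ?_
  change f (x.out * g) = f ((σ g⁻¹ (σ g x)).out * g)
  rw [show σ g⁻¹ (σ g x) = x from e.left_inv x]

theorem cosetSum_eq_apply_one {S : Type*} [AddCommMonoid S] {m : ℕ} {f : GLn m F → S}
    (hf : ∀ u ∈ maxUnip F m, ∀ x, f (u * x) = f x) (h0 : ∀ x ∉ maxUnip F m, f x = 0) :
    cosetSum f = f 1 := by
  have hmk : ∀ x : Quotient (QuotientGroup.rightRel (maxUnip F m)),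
      x.out ∈ maxUnip F m ↔ x = Quotient.mk _ 1 := by
    intro x
    conv_rhs => rw [← Quotient.out_eq x, Quotient.eq, QuotientGroup.rightRel_apply, one_mul,
      inv_mem_iff]
  unfold cosetSum
  rw [finsum_eq_single _ (Quotient.mk _ 1)]
  · have := hf _ ((hmk _).mpr rfl) 1
    rwa [mul_one] at this
  · intro x hx
    exact h0 _ fun h => hx ((hmk x).mp h)

instance {m : ℕ} : Finite (Quotient (QuotientGroup.rightRel (maxUnip F m))) :=
  Quotient.finite _

theorem cosetSum_add {S : Type*} [AddCommMonoid S] {m : ℕ} (f f' : GLn m F → S) :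
    cosetSum (fun x => f x + f' x) = cosetSum f + cosetSum f' :=
  finsum_add_distrib (Set.toFinite _) (Set.toFinite _)

theorem cosetSum_mul_left {R : Type*} [CommRing R] {m : ℕ} (c : R) (f : GLn m F → R) :
    cosetSum (fun x => c * f x) = c * cosetSum f :=
  (mul_finsum' _ _ (Set.toFinite _)).symm

theorem map_cosetSum {S S' : Type*} [AddCommMonoid S] [AddCommMonoid S'] (φ : S →+ S') {m : ℕ}
    (f : GLn m F → S) : φ (cosetSum f) = cosetSum fun x => φ (f x) :=
  φ.map_finsum (Set.toFinite _)

end CosetSum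

/-! ### The zeta forms -/

section Zeta

variable {F : Type*} [Field F] [Fintype F] {R : Type u} [CommRing R]

set_option linter.unusedSectionVars false

/-- The zeta sum as a bilinear form on functions. -/
def zetaForm (F : Type*) [Field F] [Fintype F] (R : Type u) [CommRing R] {m r n : ℕ}
    (h : m + (r + 1) = n) : (GLn n F → R) →ₗ[R] (GLn m F → R) →ₗ[R] R :=
  LinearMap.mk₂ R (zetaSum h)
    (fun _ _ _ => by
      unfold zetaSum
      rw [← cosetSum_add]
      simp [add_mul])
    (fun _ _ _ => by
      unfold zetaSum
      rw [smul_eq_mul, ← cosetSum_mul_left]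
      simp [mul_assoc])
    (fun _ _ _ => by
      unfold zetaSum
      rw [← cosetSum_add]
      simp [mul_add])
    (fun _ _ _ => by
      unfold zetaSum
      rw [smul_eq_mul, ← cosetSum_mul_left]
      simp [mul_left_comm])

/-- The dual zeta sum as a bilinear form on functions. -/
def dualZetaForm (F : Type*) [Field F] [Fintype F] (R : Type u) [CommRing R] {m r n : ℕ}
    (h : m + (r + 1) = n) : (GLn n F → R) →ₗ[R] (GLn m F → R) →ₗ[R] R :=
  LinearMap.mk₂ R (dualZetaSum h)
    (fun _ _ _ => by
      unfold dualZetaSum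
      simp_rw [finsum_eq_sum_of_fintype]
      rw [← cosetSum_add]
      simp [add_mul, Finset.sum_add_distrib])
    (fun _ _ _ => by
      unfold dualZetaSum
      simp_rw [finsum_eq_sum_of_fintype]
      rw [smul_eq_mul, ← cosetSum_mul_left]
      simp [mul_assoc, Finset.mul_sum])
    (fun _ _ _ => by
      unfold dualZetaSum
      simp_rw [finsum_eq_sum_of_fintype]
      rw [← cosetSum_add]
      simp [mul_add, Finset.sum_add_distrib])
    (fun _ _ _ => by
      unfold dualZetaSum
      simp_rw [finsum_eq_sum_of_fintype]
      rw [smul_eq_mul, ← cosetSum_mul_left]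
      simp [mul_left_comm, Finset.mul_sum])

theorem map_zetaSum {R' : Type*} [CommRing R'] (φ : R →+* R') {m r n : ℕ} (h : m + (r + 1) = n)
    (W : GLn n F → R) (W' : GLn m F → R) :
    zetaSum h (fun g => φ (W g)) (fun g => φ (W' g)) = φ (zetaSum h W W') := by
  unfold zetaSum
  have := map_cosetSum φ.toAddMonoidHom fun x => W (corner h x) * W' x
  refine Eq.trans ?_ this.symm
  simp

theorem map_dualZetaSum {R' : Type*} [CommRing R'] (φ : R →+* R') {m r n : ℕ}
    (h : m + (r + 1) = n) (W : GLn n F → R) (W' : GLn m F → R) :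
    dualZetaSum h (fun g => φ (W g)) (fun g => φ (W' g)) = φ (dualZetaSum h W W') := by
  unfold dualZetaSum
  simp_rw [finsum_eq_sum_of_fintype]
  have := map_cosetSum φ.toAddMonoidHom fun x =>
    ∑ y : Matrix (Fin m) (Fin r) F, W (dualElt h x y) * W' x
  refine Eq.trans ?_ this.symm
  simp [map_sum]

/-- The elements of `U_{n,r}`, where `n = m + 1 + r`, in blocks of sizes `m` and `r + 1`. -/
theorem exists_eq_upperBlock_of_mem_unipSubgroup {m r n : ℕ} (h : m + (r + 1) = n) {u : GLn n F}
    (hu : u ∈ unipSubgroup F n r) : ∃ (z : Matrix (Fin m) (Fin (r + 1)) F) (v : GLn (r + 1) F),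
      v ∈ maxUnip F (r + 1) ∧ (∀ i, z i 0 = 0) ∧ u = upperBlock h 1 z v := by
  have hform : ∀ q ∈ unipSubgroup F n r, ∃ B D, q.1 = blockMatrix h 1 B 0 D ∧
      ∀ i, B i 0 = 0 := by
    intro q hq
    obtain ⟨A, B, C, D, hABCD⟩ := exists_eq_blockMatrix h q.1
    have hA : A = 1 := by
      ext i j
      have := hq (blockEquiv h (.inl i)) (blockEquiv h (.inl j)) (Or.inr (by simp; omega))
      rw [hABCD] at this
      simpa [Matrix.one_apply] using this
    have hC : C = 0 := by
      ext i j
      have := hq (blockEquiv h (.inr i)) (blockEquiv h (.inl j)) (Or.inr (by simp; omega))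
      rw [hABCD] at this
      simpa [Matrix.one_apply] using this
    refine ⟨B, D, by rw [hABCD, hA, hC], fun i => ?_⟩
    have := hq (blockEquiv h (.inl i)) (blockEquiv h (.inr 0))
      (Or.inr (by rw [blockEquiv_inr_val, Fin.val_zero]; omega))
    rw [hABCD] at this
    simpa [Matrix.one_apply] using this
  obtain ⟨z, D, hzD, hz⟩ := hform u hu
  obtain ⟨z', D', hzD', -⟩ := hform u⁻¹ (inv_mem hu)
  have hinj : ∀ {D₁ D₂ : Matrix (Fin (r + 1)) (Fin (r + 1)) F} {B₁ B₂},
      blockMatrix h 1 B₁ 0 D₁ = blockMatrix h 1 B₂ 0 D₂ → D₁ = D₂ := by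
    intro D₁ D₂ B₁ B₂ hD
    ext i j
    have := congrFun (congrFun hD (blockEquiv h (.inr i))) (blockEquiv h (.inr j))
    simpa using this
  have h1 : D * D' = 1 := by
    have : u.1 * (u⁻¹).1 = 1 := by rw [← Units.val_mul, mul_inv_cancel, Units.val_one]
    rw [hzD, hzD', blockMatrix_mul, ← blockMatrix_one h] at this
    exact hinj (by simpa using this)
  have h2 : D' * D = 1 := by
    have : (u⁻¹).1 * u.1 = 1 := by rw [← Units.val_mul, inv_mul_cancel, Units.val_one]
    rw [hzD, hzD', blockMatrix_mul, ← blockMatrix_one h] at this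
    exact hinj (by simpa using this)
  have heq : u = upperBlock h 1 z ⟨D, D', h1, h2⟩ := Units.ext hzD
  refine ⟨z, ⟨D, D', h1, h2⟩, ?_, hz, heq⟩
  exact ((upperBlock_mem_maxUnip h).mp (heq ▸ unipSubgroup_le_maxUnip n r hu)).2

theorem superdiagSum_upperBlock_of_col_zero {m r n : ℕ} (h : m + (r + 1) = n) (x : GLn m F)
    {z : Matrix (Fin m) (Fin (r + 1)) F} (hz : ∀ i, z i 0 = 0) (v : GLn (r + 1) F) :
    superdiagSum (upperBlock h x z v) = superdiagSum x + superdiagSum v := by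
  rw [superdiagSum_upperBlock, add_eq_left]
  refine Finset.sum_eq_zero fun i _ => Finset.sum_eq_zero fun j _ => ?_
  split_ifs with hij
  · have : j = 0 := Fin.ext (by rw [Fin.val_zero]; omega)
    rw [this, hz]
  · rfl

variable {ψ : AddChar F R}

theorem zetaSum_summand_invariant {m r n : ℕ} (h : m + (r + 1) = n) {W : GLn n F → R}
    {W' : GLn m F → R} (hW : W ∈ whittakerFunctions F R ψ n)
    (hW' : W' ∈ whittakerFunctions F R ψ⁻¹ m) {u : GLn m F} (hu : u ∈ maxUnip F m) (x : GLn m F) :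
    W (corner h (u * x)) * W' (u * x) = W (corner h x) * W' x := by
  rw [map_mul, hW _ ((corner_mem_maxUnip h).mpr hu), hW' _ hu, superdiagSum_corner,
    mul_mul_mul_comm, AddChar.inv_apply, ← AddChar.map_add_eq_mul, add_neg_cancel,
    AddChar.map_zero_eq_one, one_mul]

theorem zetaSum_equivariant {m r n : ℕ} (h : m + (r + 1) = n) {W : GLn n F → R}
    {W' : GLn m F → R} (hW : W ∈ whittakerFunctions F R ψ n)
    (hW' : W' ∈ whittakerFunctions F R ψ⁻¹ m) (g : GLn m F) {u : GLn n F}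
    (hu : u ∈ unipSubgroup F n r) :
    zetaSum h (fun x => W (x * (corner h g * u))) (fun x => W' (x * g)) =
      ψ (superdiagSum u) * zetaSum h W W' := by
  obtain ⟨z, v, hv, hz, rfl⟩ := exists_eq_upperBlock_of_mem_unipSubgroup h hu
  have key : ∀ x : GLn m F, W (corner h x * (corner h g * upperBlock h 1 z v)) =
      ψ (superdiagSum (upperBlock h 1 z v)) * W (corner h (x * g)) := by
    intro x
    have h1 : corner h x * (corner h g * upperBlock h 1 z v) =
        upperBlock h 1 ((x * g).1 * z) v * corner h (x * g) := by
      rw [← mul_assoc, ← map_mul, corner_eq_upperBlock, upperBlock_mul, upperBlock_mul]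
      simp
    have h2 : ∀ i, ((x * g).1 * z) i 0 = 0 := fun i => by
      rw [Matrix.mul_apply]
      exact Finset.sum_eq_zero fun k _ => by rw [hz, mul_zero]
    rw [h1, hW _ ((upperBlock_mem_maxUnip h).mpr ⟨one_mem _, hv⟩),
      superdiagSum_upperBlock_of_col_zero h 1 h2, superdiagSum_upperBlock_of_col_zero h 1 hz]
  unfold zetaSum
  simp_rw [key, mul_assoc]
  rw [cosetSum_mul_left]
  congr 1
  exact cosetSum_mul_right (f := fun x => W (corner h x) * W' x)
    (fun u hu x => zetaSum_summand_invariant h hW hW' hu x) g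

/-- The matrix `(A B; C D)` with a block `C` of size `m × m` and a block `B` of size `b × b`,
indexed by `Fin n` with `n = m + b`. -/
def swapMatrix {m b n : ℕ} (h : m + b = n) (A : Matrix (Fin b) (Fin m) F)
    (B : Matrix (Fin b) (Fin b) F) (C : Matrix (Fin m) (Fin m) F) (D : Matrix (Fin m) (Fin b) F) :
    Matrix (Fin n) (Fin n) F :=
  Matrix.reindex (blockEquiv ((Nat.add_comm _ _).trans h)) (blockEquiv h)
    (Matrix.fromBlocks A B C D)

theorem swapMatrix_mul {m b n : ℕ} (h : m + b = n) (A : Matrix (Fin b) (Fin m) F)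
    (B : Matrix (Fin b) (Fin b) F) (C : Matrix (Fin m) (Fin m) F) (D : Matrix (Fin m) (Fin b) F)
    (A' : Matrix (Fin m) (Fin m) F) (B' : Matrix (Fin m) (Fin b) F)
    (C' : Matrix (Fin b) (Fin m) F) (D' : Matrix (Fin b) (Fin b) F) :
    swapMatrix h A B C D * blockMatrix h A' B' C' D' =
      swapMatrix h (A * A' + B * C') (A * B' + B * D') (C * A' + D * C') (C * B' + D * D') := by
  simp only [blockMatrix, swapMatrix, Matrix.reindex_apply]
  rw [Matrix.submatrix_mul_equiv, Matrix.fromBlocks_multiply]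

theorem mul_swapMatrix {m b n : ℕ} (h : m + b = n) (h' : b + m = n)
    (A' : Matrix (Fin m) (Fin m) F) (B' : Matrix (Fin m) (Fin b) F)
    (C' : Matrix (Fin b) (Fin m) F) (D' : Matrix (Fin b) (Fin b) F) (A : Matrix (Fin b) (Fin m) F)
    (B : Matrix (Fin b) (Fin b) F) (C : Matrix (Fin m) (Fin m) F)
    (D : Matrix (Fin m) (Fin b) F) :
    blockMatrix h' D' C' B' A' * swapMatrix h A B C D =
      swapMatrix h (D' * A + C' * C) (D' * B + C' * D) (B' * A + A' * C) (B' * B + A' * D) := by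
  simp only [blockMatrix, swapMatrix, Matrix.reindex_apply]
  rw [Matrix.submatrix_mul_equiv, Matrix.fromBlocks_multiply]

/-- The matrix `(0 | y)` of size `m × (r + 1)`. -/
def consCol {m r : ℕ} (y : Matrix (Fin m) (Fin r) F) : Matrix (Fin m) (Fin (r + 1)) F :=
  fun i => Fin.cons 0 (y i)

theorem coe_dualElt {m r n : ℕ} (h : m + (r + 1) = n) (x : GLn m F)
    (y : Matrix (Fin m) (Fin r) F) :
    (dualElt h x y).1 = swapMatrix h 0 1 x.1 (consCol y) := rfl

theorem consCol_injective {m r : ℕ} :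
    Function.Injective (consCol : Matrix (Fin m) (Fin r) F → _) := by
  intro y y' hy
  ext i j
  have := congrFun (congrFun hy i) j.succ
  simpa [consCol] using this

theorem exists_eq_consCol {m r : ℕ} {Y : Matrix (Fin m) (Fin (r + 1)) F} (hY : ∀ i, Y i 0 = 0) :
    ∃ y, Y = consCol y := by
  refine ⟨fun i j => Y i j.succ, ?_⟩
  ext i j
  refine Fin.cases ?_ (fun j => ?_) j
  · exact hY i
  · rfl

theorem consCol_zero {m r : ℕ} : consCol (0 : Matrix (Fin m) (Fin r) F) = 0 := by
  ext i j
  refine Fin.cases rfl (fun j => rfl) j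

theorem mul_consCol {m r : ℕ} (x : Matrix (Fin m) (Fin m) F) (y : Matrix (Fin m) (Fin r) F) :
    x * consCol y = consCol (x * y) := by
  ext i j
  refine Fin.cases ?_ (fun j => ?_) j
  · simp [Matrix.mul_apply, consCol]
  · simp [Matrix.mul_apply, consCol]

theorem dualElt_mul_corner {m r n : ℕ} (h : m + (r + 1) = n) (x g : GLn m F)
    (y : Matrix (Fin m) (Fin r) F) : dualElt h x y * corner h g = dualElt h (x * g) y := by
  apply Units.ext
  rw [Units.val_mul, coe_dualElt, coe_corner, swapMatrix_mul, coe_dualElt]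
  simp

/-- Right translation by `U_{n,r}` permutes the matrices `(0 1 0; 0 0 I_r; x 0 y)`, up to left
multiplication by `N_n`. -/
theorem exists_dualElt_mul {m r n : ℕ} (h : m + (r + 1) = n) (h' : r + 1 + m = n) (x : GLn m F)
    {z : Matrix (Fin m) (Fin (r + 1)) F} {v : GLn (r + 1) F} (hv : v ∈ maxUnip F (r + 1))
    (hz : ∀ i, z i 0 = 0) : ∃ φ : Matrix (Fin m) (Fin r) F → Matrix (Fin m) (Fin r) F,
      Function.Bijective φ ∧
      ∀ y, dualElt h x y * upperBlock h 1 z v = corner h' v * dualElt h x (φ y) := by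
  have hv0 : ∀ i : Fin r, v.1 i.succ 0 = 0 := fun i => by
    rw [hv _ _ (Or.inl (Fin.zero_le _)), Matrix.one_apply_ne (Fin.succ_ne_zero i)]
  have hcol : ∀ y : Matrix (Fin m) (Fin r) F, ∃ y', x.1 * z + consCol y * v.1 = consCol y' := by
    intro y
    refine exists_eq_consCol fun i => ?_
    rw [Matrix.add_apply, Matrix.mul_apply, Matrix.mul_apply, Finset.sum_eq_zero, zero_add,
      Finset.sum_eq_zero]
    · intro k _
      refine Fin.cases ?_ (fun k => ?_) k
      · simp [consCol]
      · rw [hv0, mul_zero]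
    · intro k _
      rw [hz, mul_zero]
  choose φ hφ using hcol
  refine ⟨φ, Finite.injective_iff_bijective.mp fun y y' hyy => ?_, fun y => ?_⟩
  · have h1 : consCol y * v.1 = consCol y' * v.1 := by
      have := (hφ y).trans (hyy ▸ (hφ y').symm)
      exact add_left_cancel this
    apply consCol_injective
    have h2 := congrArg (· * (v⁻¹).1) h1
    simp only [Matrix.mul_assoc, ← Units.val_mul, mul_inv_cancel, Units.val_one,
      Matrix.mul_one] at h2
    exact h2
  · apply Units.ext
    rw [Units.val_mul, Units.val_mul, coe_dualElt, coe_upperBlock, coe_corner, swapMatrix_mul,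
      coe_dualElt, mul_swapMatrix, ← hφ]
    simp

theorem dualElt_mul_left {m r n : ℕ} (h : m + (r + 1) = n) (h' : r + 1 + m = n) (u x : GLn m F)
    (y : Matrix (Fin m) (Fin r) F) :
    dualElt h (u * x) (u.1 * y) = upperBlock h' 1 0 u * dualElt h x y := by
  apply Units.ext
  rw [Units.val_mul, coe_dualElt, coe_dualElt, coe_upperBlock, mul_swapMatrix, ← mul_consCol]
  simp

/-- Left multiplication by an invertible matrix, as a permutation of the matrices. -/
def mulLeftEquiv {m r : ℕ} (u : GLn m F) : Matrix (Fin m) (Fin r) F ≃ Matrix (Fin m) (Fin r) F where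
  toFun y := u.1 * y
  invFun y := (u⁻¹).1 * y
  left_inv y := by
    change (u⁻¹).1 * (u.1 * y) = y
    rw [← Matrix.mul_assoc, ← Units.val_mul, inv_mul_cancel]; simp
  right_inv y := by
    change u.1 * ((u⁻¹).1 * y) = y
    rw [← Matrix.mul_assoc, ← Units.val_mul, mul_inv_cancel]; simp

theorem dualZetaSum_summand_invariant {m r n : ℕ} (h : m + (r + 1) = n) {W : GLn n F → R}
    {W' : GLn m F → R} (hW : W ∈ whittakerFunctions F R ψ n)
    (hW' : W' ∈ whittakerFunctions F R ψ⁻¹ m) {u : GLn m F} (hu : u ∈ maxUnip F m) (x : GLn m F) :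
    ∑ᶠ y : Matrix (Fin m) (Fin r) F, W (dualElt h (u * x) y) * W' (u * x) =
      ∑ᶠ y : Matrix (Fin m) (Fin r) F, W (dualElt h x y) * W' x := by
  have h' : r + 1 + m = n := by omega
  rw [← finsum_comp_equiv (mulLeftEquiv u)]
  refine finsum_congr fun y => ?_
  change W (dualElt h (u * x) (u.1 * y)) * W' (u * x) = _
  rw [dualElt_mul_left h h', hW _ ((upperBlock_mem_maxUnip h').mpr ⟨one_mem _, hu⟩), hW' _ hu,
    superdiagSum_upperBlock, superdiagSum_one, mul_mul_mul_comm, AddChar.inv_apply,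
    ← AddChar.map_add_eq_mul]
  simp

theorem dualZetaSum_equivariant {m r n : ℕ} (h : m + (r + 1) = n) {W : GLn n F → R}
    {W' : GLn m F → R} (hW : W ∈ whittakerFunctions F R ψ n)
    (hW' : W' ∈ whittakerFunctions F R ψ⁻¹ m) (g : GLn m F) {u : GLn n F}
    (hu : u ∈ unipSubgroup F n r) :
    dualZetaSum h (fun x => W (x * (corner h g * u))) (fun x => W' (x * g)) =
      ψ (superdiagSum u) * dualZetaSum h W W' := by
  have h' : r + 1 + m = n := by omega
  obtain ⟨z, v, hv, hz, rfl⟩ := exists_eq_upperBlock_of_mem_unipSubgroup h hu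
  have key : ∀ x : GLn m F, ∑ᶠ y : Matrix (Fin m) (Fin r) F,
        W (dualElt h x y * (corner h g * upperBlock h 1 z v)) * W' (x * g) =
      ψ (superdiagSum (upperBlock h 1 z v)) *
        ∑ᶠ y : Matrix (Fin m) (Fin r) F, W (dualElt h (x * g) y) * W' (x * g) := by
    intro x
    obtain ⟨φ, hφ, hφy⟩ := exists_dualElt_mul h h' (x * g) hv hz
    rw [← finsum_comp_equiv (Equiv.ofBijective φ hφ)
      (f := fun y => W (dualElt h (x * g) y) * W' (x * g)), mul_finsum' _ _ (Set.toFinite _)]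
    refine finsum_congr fun y => ?_
    rw [← mul_assoc (dualElt h x y), dualElt_mul_corner, hφy,
      hW _ ((corner_mem_maxUnip h').mpr hv), superdiagSum_corner,
      superdiagSum_upperBlock_of_col_zero h 1 hz, superdiagSum_one, zero_add, mul_assoc]
    rfl
  unfold dualZetaSum
  simp_rw [key]
  rw [cosetSum_mul_left]
  congr 1
  exact cosetSum_mul_right
    (f := fun x => ∑ᶠ y : Matrix (Fin m) (Fin r) F, W (dualElt h x y) * W' x)
    (fun u hu x => dualZetaSum_summand_invariant h hW hW' hu x) g

/-- On `GL_m` a Bessel function is supported on `N_m`, so the zeta sum collapses to one term. -/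
theorem zetaSum_bessel (hψ : IsFourierChar ψ) {m r n : ℕ} (h : m + (r + 1) = n) {W : GLn n F → R}
    {W' : GLn m F → R} (hW : IsBessel ψ W) (hW' : W' ∈ whittakerFunctions F R ψ⁻¹ m) :
    zetaSum h W W' = W 1 * W' 1 := by
  unfold zetaSum
  rw [cosetSum_eq_apply_one (fun u hu x => zetaSum_summand_invariant h hW.left hW' hu x), map_one]
  intro x hx
  rw [hW.corner_eq_zero hψ h hx, zero_mul]

theorem dualElt_mul_inv {m r n : ℕ} (h : m + (r + 1) = n) (h' : r + 1 + m = n) (x : GLn m F)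
    (y : Matrix (Fin m) (Fin r) F) :
    (dualElt h x y * (dualElt h 1 0)⁻¹).1 = blockMatrix h' 1 0 (consCol y) x.1 := by
  have h1 : dualElt h x y = dualElt h x y * (dualElt h 1 0)⁻¹ * dualElt h 1 0 := by simp
  have h2 : (dualElt h x y).1 = blockMatrix h' 1 0 (consCol y) x.1 * (dualElt h 1 0).1 := by
    rw [coe_dualElt, coe_dualElt, mul_swapMatrix, consCol_zero]
    simp
  rw [Units.val_mul, h2, Matrix.mul_assoc, ← Units.val_mul, mul_inv_cancel]
  simp

/-- For a translate of a Bessel function, the dual zeta sum collapses to one term: the matrices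
`(I_{r+1} 0; (0 y) x)` have the first column of the identity matrix. -/
theorem dualZetaSum_bessel (hψ : IsFourierChar ψ) {m r n : ℕ} (h : m + (r + 1) = n)
    {W : GLn n F → R} {W' : GLn m F → R} (hW : IsBessel ψ W)
    (hW' : W' ∈ whittakerFunctions F R ψ⁻¹ m) :
    dualZetaSum h (fun g => W (g * (dualElt h 1 0)⁻¹)) W' = W 1 * W' 1 := by
  have h' : r + 1 + m = n := by omega
  have hsupp : ∀ x y, (x ∉ maxUnip F m ∨ y ≠ 0) →
      W (dualElt h x y * (dualElt h 1 0)⁻¹) = 0 := by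
    intro x y hxy
    obtain ⟨n', rfl⟩ : ∃ n', n = n' + 1 := ⟨m + r, by omega⟩
    have h0 : (0 : Fin (n' + 1)) = blockEquiv h' (.inl 0) := Fin.ext (by simp)
    refine hW.eq_zero_of_first_col hψ (fun i => ?_) fun hmem => ?_
    · rw [dualElt_mul_inv h h', h0]
      obtain ⟨i, rfl⟩ := (blockEquiv h').surjective i
      rcases i with i | i
      · rw [blockMatrix_inl_inl]; simp [Matrix.one_apply]
      · rw [blockMatrix_inr_inl]; simp [consCol]
    · rcases hxy with hx | hy
      · apply hx
        intro i j hij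
        have := hmem (blockEquiv h' (.inr i)) (blockEquiv h' (.inr j))
          (by left; rw [Fin.le_def]; simp; omega)
        rw [dualElt_mul_inv h h', blockMatrix_inr_inr] at this
        simpa [Matrix.one_apply] using this
      · apply hy
        apply consCol_injective
        rw [consCol_zero]
        ext i j
        have := hmem (blockEquiv h' (.inr i)) (blockEquiv h' (.inl j))
          (by left; rw [Fin.le_def]; simp; omega)
        rw [dualElt_mul_inv h h', blockMatrix_inr_inl] at this
        simpa [Matrix.one_apply] using this
  have hleft : (fun g => W (g * (dualElt h 1 0)⁻¹)) ∈ whittakerFunctions F R ψ n := by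
    intro u hu g
    change W (u * g * _) = _ * W (g * _)
    rw [mul_assoc, hW.left u hu]
  unfold dualZetaSum
  rw [cosetSum_eq_apply_one
    (f := fun x => ∑ᶠ y : Matrix (Fin m) (Fin r) F, W (dualElt h x y * (dualElt h 1 0)⁻¹) * W' x)
    (fun u hu x => dualZetaSum_summand_invariant h hleft hW' hu x), finsum_eq_single _ 0]
  · rw [mul_inv_cancel]
  · intro y hy
    rw [hsupp 1 y (Or.inr hy), zero_mul]
  · intro x hx
    refine finsum_eq_zero_of_forall_eq_zero fun y => ?_
    rw [hsupp x y (Or.inl hx), zero_mul]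

end Zeta

/-! ### Existence of the gamma factor -/

section Gamma

variable {F : Type*} [Field F] [Fintype F] {R : Type u} [CommRing R] {ψ : AddChar F R}

set_option linter.unusedSectionVars false

theorem whittakerModel_translate {n : ℕ} {V : Rep.{v} R (GLn n F)} {W : GLn n F → R}
    (hW : W ∈ whittakerModel ψ V) (a : GLn n F) : (fun g => W (g * a)) ∈ whittakerModel ψ V :=
  whittakerModel_le_comap ψ V a hW

/-- A bilinear form on functions, restricted to the Whittaker models. -/
def restrictForm {n m : ℕ} (V : Rep.{v} R (GLn n F)) (V' : Rep.{w} R (GLn m F))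
    (B : (GLn n F → R) →ₗ[R] (GLn m F → R) →ₗ[R] R) :
    (whittakerRep ψ V).V →ₗ[R] (whittakerRep ψ⁻¹ V').V →ₗ[R] R :=
  B.domRestrict₁₂ (whittakerModel ψ V) (whittakerModel ψ⁻¹ V')

/-- The pair of Bessel functions determines an equivariant form; the zeta sum takes the value `1`
there, hence is a basis. The dual zeta sum is the multiple of it by its own value `γ` there, and
`γ` divides `1`, the value of the dual zeta sum at a translate. The last clause of the conclusion
survives extension of scalars and pins down `γ`. -/
theorem exists_basis_and_gamma (hψ : IsFourierChar ψ) {m r n : ℕ} (hm : 1 ≤ m) (h : m + (r + 1) = n)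
    (V : Rep.{v} R (GLn n F)) (V' : Rep.{w} R (GLn m F)) (hV : IsWhittakerType ψ V)
    (hV' : IsWhittakerType ψ⁻¹ V') (hex : ¬ IsExceptional ψ V V') :
    (∃ b : Module.Basis Unit R (equivariantForms ψ h V V'),
      ∀ W W', (b ()).1 W W' = zetaSum h W.1 W'.1) ∧
    ∃ γ : Rˣ, FunctionalEquation ψ h V V' γ ∧
      ∃ W ∈ whittakerModel ψ V, ∃ W' ∈ whittakerModel ψ⁻¹ V', zetaSum h W W' = 1 := by
  obtain ⟨d, rfl⟩ := Nat.exists_eq_add_of_le' hm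
  subst h
  let h : d + 1 + (r + 1) = d + 1 + (r + 1) := rfl
  obtain ⟨W₀, hW₀1, hW₀, hW₀c⟩ := exists_bessel (n := d + 1 + r) hψ hV
  obtain ⟨W₀', hW₀'1, hW₀', hW₀'c⟩ := exists_bessel hψ.inv hV'
  have hfun : ∀ W : (whittakerRep ψ V).V, W.1 ∈ whittakerFunctions F R ψ (d + 1 + (r + 1)) :=
    fun W => whittakerModel_le_whittakerFunctions (n := d + 1 + r) hV W.2
  have hfun' : ∀ W : (whittakerRep ψ⁻¹ V').V, W.1 ∈ whittakerFunctions F R ψ⁻¹ (d + 1) :=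
    fun W => whittakerModel_le_whittakerFunctions hV' W.2
  let I : equivariantForms ψ h V V' := ⟨restrictForm V V' (zetaForm F R h),
    fun g u hu W W' => zetaSum_equivariant h (hfun W) (hfun' W') g hu⟩
  let J : equivariantForms ψ h V V' := ⟨restrictForm V V' (dualZetaForm F R h),
    fun g u hu W W' => dualZetaSum_equivariant h (hfun W) (hfun' W') g hu⟩
  have hI : ∀ W W', I.1 W W' = zetaSum h W.1 W'.1 := fun _ _ => rfl
  have hJ : ∀ W W', J.1 W W' = dualZetaSum h W.1 W'.1 := fun _ _ => rfl
  have hI1 : I.1 W₀ W₀' = 1 := by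
    rw [hI, zetaSum_bessel hψ h hW₀ (hfun' W₀'), hW₀1, hW₀'1, mul_one]
  -- an equivariant form is determined by its value at the pair of Bessel functions
  have hdet : ∀ B : equivariantForms ψ h V V', ∀ W W',
      B.1 W W' = B.1 W₀ W₀' * zetaSum h W.1 W'.1 := by
    intro B W W'
    have hmem : B.1 + (-B.1 W₀ W₀') • I.1 ∈ equivariantForms ψ h V V' :=
      Submodule.add_mem _ B.2 (Submodule.smul_mem _ _ I.2)
    have hval : ∀ W W', (B.1 + (-B.1 W₀ W₀') • I.1) W W' =
        B.1 W W' + (-B.1 W₀ W₀') * zetaSum h W.1 W'.1 := fun _ _ => rfl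
    have h0 : B.1 + (-B.1 W₀ W₀') • I.1 = 0 := by
      refine eq_zero_of_mem_equivariantForms hψ hex hmem fun x y hx hy => ?_
      obtain ⟨a, rfl⟩ := hW₀c x hx
      obtain ⟨b, rfl⟩ := hW₀'c y hy
      rw [map_smul, map_smul, LinearMap.smul_apply, hval, ← hI, hI1, mul_one, add_neg_cancel,
        smul_zero, smul_zero]
    have h1 := hval W W'
    rw [h0] at h1
    have h2 : (0 : R) = B.1 W W' + (-B.1 W₀ W₀') * zetaSum h W.1 W'.1 := h1
    linear_combination -h2
  let e : R ≃ₗ[R] equivariantForms ψ h V V' :=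
    LinearEquiv.ofBijective (LinearMap.toSpanSingleton R _ I) ⟨fun a b hab => by
      have := congrArg (fun B : equivariantForms ψ h V V' => B.1 W₀ W₀') hab
      change a * I.1 W₀ W₀' = b * I.1 W₀ W₀' at this
      rwa [hI1, mul_one, mul_one] at this,
      fun B => ⟨B.1 W₀ W₀', Subtype.ext (LinearMap.ext fun W => LinearMap.ext fun W' =>
        (hdet B W W').symm)⟩⟩
  refine ⟨⟨(Module.Basis.singleton Unit R).map e, fun W W' => ?_⟩, ?_⟩
  · have : ((Module.Basis.singleton Unit R).map e) () = (1 : R) • I := by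
      rw [Module.Basis.map_apply, Module.Basis.singleton_apply]
      rfl
    rw [this]
    exact one_mul (zetaSum h W.1 W'.1)
  · have hFE : ∀ (W : (whittakerRep ψ V).V) (W' : (whittakerRep ψ⁻¹ V').V),
        zetaSum h W.1 W'.1 * J.1 W₀ W₀' = dualZetaSum h W.1 W'.1 := by
      intro W W'
      rw [← hJ W W', hdet J W W', mul_comm]
    -- the dual zeta sum takes the value `1` at a translate of the pair of Bessel functions
    have hunit : IsUnit (J.1 W₀ W₀') := by
      have h1 := hFE ⟨_, whittakerModel_translate W₀.2 (dualElt h 1 0)⁻¹⟩ W₀'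
      rw [dualZetaSum_bessel hψ h hW₀ (hfun' W₀'), hW₀1, hW₀'1, mul_one] at h1
      exact IsUnit.of_mul_eq_one_right _ h1
    obtain ⟨γ, hγ⟩ := hunit
    refine ⟨γ, fun W hW W' hW' => ?_, W₀.1, W₀.2, W₀'.1, W₀'.2, hI1⟩
    rw [hγ]
    exact hFE ⟨W, hW⟩ ⟨W', hW'⟩

theorem FunctionalEquation.iff_eq {m r n : ℕ} {h : m + (r + 1) = n} {V : Rep.{v} R (GLn n F)}
    {V' : Rep.{w} R (GLn m F)} {γ : R} (hγ : FunctionalEquation ψ h V V' γ)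
    (h1 : ∃ W ∈ whittakerModel ψ V, ∃ W' ∈ whittakerModel ψ⁻¹ V', zetaSum h W W' = 1) (c : R) :
    FunctionalEquation ψ h V V' c ↔ c = γ := by
  refine ⟨fun hc => ?_, fun hc => hc ▸ hγ⟩
  obtain ⟨W, hW, W', hW', h1⟩ := h1
  rw [← one_mul c, ← one_mul γ, ← h1, hc W hW W' hW', hγ W hW W' hW']

end Gamma

/-! ### Extension of scalars -/

section BaseChange

variable {F : Type*} [Field F] [Fintype F] {R : Type u} [CommRing R] {ψ : AddChar F R}
  {R' : Type u'} [CommRing R'] [Algebra R R'] {ψ' : AddChar F R'}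

set_option linter.unusedSectionVars false

section
variable {G : Type*} [Group G] (V : Rep.{v} R G)

/-- The pure tensor `a ⊗ x`, as a vector of the representation `V ⊗_R R'`. -/
def pureTensor (a : R') (x : V.V) : (baseChange R' V).V := a ⊗ₜ[R] x

theorem pureTensor_rho (g : G) (a : R') (x : V.V) :
    (baseChange R' V).ρ g (pureTensor V a x) = pureTensor V a (V.ρ g x) := rfl

theorem pureTensor_zero (a : R') : pureTensor V a 0 = 0 := TensorProduct.tmul_zero _ _

theorem pureTensor_add (a : R') (x y : V.V) :
    pureTensor V a (x + y) = pureTensor V a x + pureTensor V a y := TensorProduct.tmul_add _ _ _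

theorem pureTensor_sub (a : R') (x y : V.V) :
    pureTensor V a (x - y) = pureTensor V a x - pureTensor V a y := TensorProduct.tmul_sub _ _ _

theorem pureTensor_smul (a : R') (c : R) (x : V.V) :
    pureTensor V a (c • x) = algebraMap R R' c • pureTensor V a x := by
  refine (TensorProduct.tmul_smul c a x).trans ?_
  exact (algebraMap_smul R' c (a ⊗ₜ[R] x)).symm

theorem smul_pureTensor (b a : R') (x : V.V) :
    b • pureTensor V a x = pureTensor V (b * a) x := rfl

variable {V} in
theorem baseChange_induction {P : (baseChange R' V).V → Prop} (x : (baseChange R' V).V)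
    (h0 : P 0) (hadd : ∀ x y, P x → P y → P (x + y)) (hpure : ∀ a x, P (pureTensor V a x)) :
    P x :=
  TensorProduct.induction_on (motive := P) x h0 hpure hadd

variable {V} (R') in
/-- The extension of scalars of a linear form. -/
def extendForm (l : V.V →ₗ[R] R) : (baseChange R' V).V →ₗ[R'] R' :=
  (TensorProduct.AlgebraTensorModule.rid R R' R').toLinearMap ∘ₗ l.baseChange R'

variable {V} in
theorem extendForm_pureTensor (l : V.V →ₗ[R] R) (a : R') (x : V.V) :
    extendForm R' l (pureTensor V a x) = a * algebraMap R R' (l x) := by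
  have h : extendForm R' l (pureTensor V a x) = l x • a :=
    rfl
  rw [h, Algebra.smul_def, mul_comm]

end

variable {n : ℕ} {V : Rep.{v} R (GLn (n + 1) F)} {l : V.V →ₗ[R] R}

/-- Coinvariants commute with extension of scalars. -/
theorem IsWhittakerFunctional.baseChange (hψ : ∀ x, ψ' x = algebraMap R R' (ψ x))
    (hl : IsWhittakerFunctional ψ V l) :
    IsWhittakerFunctional ψ' (FiniteGL.baseChange R' V) (extendForm R' l) where
  surjective a := by
    obtain ⟨v, hv⟩ := hl.surjective 1
    refine ⟨pureTensor V a v, ?_⟩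
    rw [extendForm_pureTensor, hv, map_one, mul_one]
  ker_eq := by
    apply le_antisymm
    · obtain ⟨v, hv⟩ := hl.surjective 1
      have h1 : ∀ x ∈ whittakerKer ψ (resMirabolic V), ∀ a : R',
          pureTensor V a x ∈ whittakerKer ψ' (resMirabolic (FiniteGL.baseChange R' V)) := by
        intro x hx a
        induction hx using Submodule.span_induction with
        | mem x hx =>
          obtain ⟨u, y, rfl⟩ := hx
          refine Submodule.subset_span ⟨u, pureTensor V a y, ?_⟩
          rw [pureTensor_sub, pureTensor_smul, hψ]
          rfl
        | zero => rw [pureTensor_zero]; exact Submodule.zero_mem _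
        | add x y _ _ hx hy => rw [pureTensor_add]; exact Submodule.add_mem _ hx hy
        | smul c x _ hx => rw [pureTensor_smul]; exact Submodule.smul_mem _ _ hx
      -- modulo the coinvariants relations, every tensor is a multiple of `1 ⊗ v`
      have h2 : ∀ x : (FiniteGL.baseChange R' V).V, x - extendForm R' l x • pureTensor V 1 v ∈
          whittakerKer ψ' (resMirabolic (FiniteGL.baseChange R' V)) := by
        intro x
        induction x using baseChange_induction with
        | h0 => rw [map_zero, zero_smul, sub_zero]; exact Submodule.zero_mem _
        | hadd x y hx hy =>
          rw [map_add, add_smul, add_sub_add_comm]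
          exact Submodule.add_mem _ hx hy
        | hpure a x =>
          have h3 : x - l x • v ∈ whittakerKer ψ (resMirabolic V) := by
            rw [← hl.ker_eq, LinearMap.mem_ker, map_sub, map_smul, hv, smul_eq_mul, mul_one,
              sub_self]
          have h4 := h1 _ h3 a
          rw [pureTensor_sub, pureTensor_smul, smul_pureTensor] at h4
          rwa [extendForm_pureTensor, smul_pureTensor, mul_one, mul_comm]
      intro x hx
      have := h2 x
      rw [LinearMap.mem_ker] at hx
      rwa [hx, zero_smul, sub_zero] at this
    · refine Submodule.span_le.mpr ?_
      rintro _ ⟨u, x, rfl⟩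
      rw [SetLike.mem_coe, LinearMap.mem_ker, map_sub, sub_eq_zero, map_smul, smul_eq_mul]
      change extendForm R' l ((FiniteGL.baseChange R' V).ρ u.1 x) = _
      induction x using baseChange_induction with
      | h0 => rw [map_zero, map_zero, mul_zero]
      | hadd x y hx hy => rw [map_add, map_add, map_add, hx, hy, mul_add]
      | hpure a x =>
        rw [pureTensor_rho, extendForm_pureTensor, extendForm_pureTensor, hl.apply_maxUnip u.2,
          map_mul, hψ, mul_left_comm]

theorem IsWhittakerType.baseChange (hψ : ∀ x, ψ' x = algebraMap R R' (ψ x))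
    (hV : IsWhittakerType ψ V) : IsWhittakerType ψ' (FiniteGL.baseChange R' V) :=
  let ⟨_, hl⟩ := hV.exists_isWhittakerFunctional
  (hl.baseChange hψ).isWhittakerType

theorem map_mem_whittakerModel_baseChange (hψ : ∀ x, ψ' x = algebraMap R R' (ψ x))
    (hV : IsWhittakerType ψ V) {W : GLn (n + 1) F → R} (hW : W ∈ whittakerModel ψ V) :
    (fun g => algebraMap R R' (W g)) ∈ whittakerModel ψ' (baseChange R' V) := by
  obtain ⟨l, hl⟩ := hV.exists_isWhittakerFunctional
  rw [hl.whittakerModel_eq] at hW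
  obtain ⟨x, rfl⟩ := hW
  rw [(hl.baseChange hψ).whittakerModel_eq]
  refine ⟨pureTensor V 1 x, ?_⟩
  funext g
  rw [matrixCoeff_apply, pureTensor_rho, extendForm_pureTensor, one_mul]
  rfl

/-- Nonexceptionality need not survive extension of scalars, so the functional equation over `R'` is
obtained from that over `R`: the Whittaker model over `R'` is spanned by the image of the one
over `R`. -/
theorem whittakerModel_baseChange_le_span (hψ : ∀ x, ψ' x = algebraMap R R' (ψ x))
    (hV : IsWhittakerType ψ V) : whittakerModel ψ' (baseChange R' V) ≤
      Submodule.span R' {W | ∃ W₁ ∈ whittakerModel ψ V, W = fun g => algebraMap R R' (W₁ g)} := by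
  obtain ⟨l, hl⟩ := hV.exists_isWhittakerFunctional
  rw [(hl.baseChange hψ).whittakerModel_eq, hl.whittakerModel_eq]
  rintro _ ⟨x, rfl⟩
  induction x using baseChange_induction with
  | h0 => rw [map_zero]; exact Submodule.zero_mem _
  | hadd x y hx hy => rw [map_add]; exact Submodule.add_mem _ hx hy
  | hpure a x =>
    have : matrixCoeff (extendForm R' l) (pureTensor V a x) =
        a • fun g => algebraMap R R' (matrixCoeff l x g) := by
      funext g
      rw [matrixCoeff_apply, pureTensor_rho, extendForm_pureTensor]
      rfl
    rw [this]
    exact Submodule.smul_mem _ _ (Submodule.subset_span ⟨_, ⟨x, rfl⟩, rfl⟩)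

theorem FunctionalEquation.baseChange {m r N : ℕ} (hm : 1 ≤ m) (h : m + (r + 1) = N)
    {V : Rep.{v} R (GLn N F)} {V' : Rep.{w} R (GLn m F)}
    (hψ : ∀ x, ψ' x = algebraMap R R' (ψ x)) (hV : IsWhittakerType ψ V)
    (hV' : IsWhittakerType ψ⁻¹ V') {γ : R} (hγ : FunctionalEquation ψ h V V' γ)
    (h1 : ∃ W ∈ whittakerModel ψ V, ∃ W' ∈ whittakerModel ψ⁻¹ V', zetaSum h W W' = 1) :
    IsWhittakerType ψ' (FiniteGL.baseChange R' V) ∧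
    IsWhittakerType ψ'⁻¹ (FiniteGL.baseChange R' V') ∧
    ∀ c : R', FunctionalEquation ψ' h (FiniteGL.baseChange R' V) (FiniteGL.baseChange R' V') c ↔
      c = algebraMap R R' γ := by
  obtain ⟨d, rfl⟩ := Nat.exists_eq_add_of_le' hm
  obtain ⟨n, rfl⟩ : ∃ n, N = n + 1 := ⟨d + 1 + r, by omega⟩
  have hψi : ∀ x, ψ'⁻¹ x = algebraMap R R' (ψ⁻¹ x) := fun x => by
    rw [AddChar.inv_apply, AddChar.inv_apply, hψ]
  refine ⟨hV.baseChange hψ, hV'.baseChange hψi, FunctionalEquation.iff_eq ?_ ?_⟩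
  · let B : (GLn (n + 1) F → R') →ₗ[R'] (GLn (d + 1) F → R') →ₗ[R'] R' :=
      algebraMap R R' γ • zetaForm F R' h - dualZetaForm F R' h
    have hB : ∀ W W', B W W' =
        algebraMap R R' γ * zetaSum h W W' - dualZetaSum h W W' := fun _ _ => rfl
    suffices hB0 : ∀ W ∈ whittakerModel ψ' (FiniteGL.baseChange R' V),
        ∀ W' ∈ whittakerModel ψ'⁻¹ (FiniteGL.baseChange R' V'), B W W' = 0 by
      intro W hW W' hW'
      rw [mul_comm, ← sub_eq_zero, ← hB, hB0 W hW W' hW']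
    intro W hW W' hW'
    replace hW := whittakerModel_baseChange_le_span hψ hV hW
    replace hW' := whittakerModel_baseChange_le_span hψi hV' hW'
    induction hW using Submodule.span_induction with
    | zero => rw [map_zero, LinearMap.zero_apply]
    | add x y _ _ hx hy => rw [map_add, LinearMap.add_apply, hx, hy, add_zero]
    | smul c x _ hx => rw [map_smul, LinearMap.smul_apply, hx, smul_zero]
    | mem x hx =>
      obtain ⟨W₁, hW₁, rfl⟩ := hx
      induction hW' using Submodule.span_induction with
      | zero => rw [map_zero]
      | add x y _ _ hx hy => rw [map_add, hx, hy, add_zero]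
      | smul c x _ hx => rw [map_smul, hx, smul_zero]
      | mem x hx =>
        obtain ⟨W₁', hW₁', rfl⟩ := hx
        rw [hB, map_zetaSum (algebraMap R R'), map_dualZetaSum (algebraMap R R'), ← map_mul,
          mul_comm, hγ W₁ hW₁ W₁' hW₁', sub_self]
  · obtain ⟨W, hW, W', hW', h1⟩ := h1
    exact ⟨_, map_mem_whittakerModel_baseChange hψ hV hW, _,
      map_mem_whittakerModel_baseChange hψi hV' hW', by
        rw [map_zetaSum (algebraMap R R'), h1, map_one]⟩

end BaseChange

/-! ### Characters with values in `ℤ[1/p, ζ_p]` -/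

section Character

instance {p : ℕ} [Fact p.Prime] : IsDomain (BaseRing p) :=
  IsLocalization.isDomain_localization (powers_le_nonZeroDivisors_of_noZeroDivisors
    fun h => (Fact.out : p.Prime).ne_zero <| by
      exact_mod_cast CyclotomicRing.algebraBase_injective p ℤ ℚ
        (a₁ := (p : ℤ)) (a₂ := 0) (by simpa using h))

theorem isFourierChar_extendChar {p : ℕ} [Fact p.Prime] {F : Type*} [Field F] [Fintype F]
    [CharP F p] {ψ : AddChar F (BaseRing p)} (hψ : ψ ≠ 1) (R : Type u) [CommRing R]
    [Algebra (BaseRing p) R] : IsFourierChar (extendChar ψ R) where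
  isUnit_card := by
    obtain ⟨k, -, hk⟩ := FiniteField.card F p
    rw [hk, Nat.cast_pow]
    refine IsUnit.pow _ ?_
    have h : IsUnit (algebraMap (CyclotomicRing p ℤ ℚ) (BaseRing p) (p : CyclotomicRing p ℤ ℚ)) :=
      IsLocalization.Away.algebraMap_isUnit _
    simpa using h.map (algebraMap (BaseRing p) R)
  sum_eq_zero := by
    have h : ∑ x, ψ x = 0 := AddChar.sum_eq_zero_of_ne_one hψ
    have h' := congrArg (algebraMap (BaseRing p) R) h
    rw [map_sum, map_zero] at h'
    exact h'

end Character

end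

end FiniteGL

theorem theoremA {p : ℕ} [Fact p.Prime] {F : Type*} [Field F] [Finite F] [CharP F p]
    (ψ : AddChar F (BaseRing p)) (hψ : ψ ≠ 1)
    {A : Type*} [CommRing A] [Nontrivial A] [IsNoetherianRing A] [Algebra (BaseRing p) A]
    {n m : ℕ} (hm : 1 ≤ m) (hmn : m < n)
    (V : Rep A (GLn n F)) (V' : Rep A (GLn m F))
    (hV : IsWhittakerType (extendChar ψ A) V) (hV' : IsWhittakerType (extendChar ψ A)⁻¹ V')
    (hex : ¬ IsExceptional (extendChar ψ A) V V') :
    (∃ b : Module.Basis Unit A (equivariantForms (extendChar ψ A) (splitting hmn) V V'),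
      ∀ W W', (b ()).1 W W' = zetaSum (splitting hmn) W.1 W'.1) ∧
    ∃ γ : Aˣ,
      (∀ c : A, FunctionalEquation (extendChar ψ A) (splitting hmn) V V' c ↔ c = γ) ∧
      ∀ (A' : Type*) [CommRing A'] [Algebra (BaseRing p) A'] [Algebra A A']
        [IsScalarTower (BaseRing p) A A'],
        IsWhittakerType (extendChar ψ A') (baseChange A' V) ∧
        IsWhittakerType (extendChar ψ A')⁻¹ (baseChange A' V') ∧
        ∀ c : A', FunctionalEquation (extendChar ψ A') (splitting hmn)
          (baseChange A' V) (baseChange A' V') c ↔ c = algebraMap A A' γ := by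
  cases nonempty_fintype F
  obtain ⟨hb, γ, hγ, h1⟩ := exists_basis_and_gamma (isFourierChar_extendChar hψ A) hm
    (splitting hmn) V V' hV hV' hex
  refine ⟨hb, γ, hγ.iff_eq h1, fun A' _ _ _ _ => ?_⟩
  have hA : ∀ x, extendChar ψ A' x = algebraMap A A' (extendChar ψ A x) := fun x =>
    IsScalarTower.algebraMap_apply (BaseRing p) A A' (ψ x)
  exact hγ.baseChange hm (splitting hmn) hA hV hV' h1
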